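/- Let $G$ be a finite non-abelian group. Consider the quantum double model of $G$ on the planar square lattice with $m\times n$ plaquettes (smooth boundary, arbitrary edge orientations): there is a qudit with orthonormal basis $\{|g\rangle\}_{g\in G}$ on every edge, $A_v^g$ is the gauge transformation by $g$ at the vertex $v$, $A_v=\frac1{|G|}\sum_{g}A_v^g$, $B_p$ is the projection onto trivial flux through the plaquette $p$, and $H=-\sum_v A_v-\sum_p B_p$. For an open ribbon $\xi$ from a site $s_0=(v_0,p_0)$ to a site $s_1=(v_1,p_1)\neq s_0$ let $F_\xi^{h,g}$ $(h,g\in G)$ be the basic ribbon operators: if $y_1,\dots,y_N$ are the group elements along the primary triangles of $\xi$, then $F_\xi^{h,g}$ projects onto $y_1\cdots y_N=g$ and multiplies the group element on an edge crossed by a dual triangle preceded by $j$ primary triangles from the left by $(y_1\cdots y_j)^{-1}h\,(y_1\cdots y_j)$. For an irreducible unitary representation $\pi$ of $G$ with matrices $\Gamma_\pi(g)$ in an orthonormal basis, let $$F_\xi^{(\{e\},\pi)}=\frac{d_\pi}{|G|}\sum_{\ell\in G}\bigl(\Gamma_\pi(\ell)^{-1}\bigr)_{1,1}\,F_\xi^{e,\ell}.$$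 A local unitary circuit of range $R$ and depth $t$ is a product of $t$ layers, each of which is a product of unitary gates acting on pairwise disjoint sets of qudits, where any two endpoints of edges in one such set have graph distance at most $R$. Then there is an irreducible unitary representation $\pi$ of $G$ such that every local unitary circuit implementing $F_\xi^{(\{e\},\pi)}$ has extensive depth, in the following sense. For every $R$ there is a constant $c>0$ (depending only on $G$, $\pi$ and $R$) such that for every choice of the orthonormal basis in which $\pi$ is written, all $m,n$, all edge orientations, every open ribbon $\xi$ from $s_0=(v_0,p_0)$ to $s_1=(v_1,p_1)$, every ground state $\Psi$ of $H$, and every local unitary circuit $U$ of range $R$ and depth $t$ for which $U\Psi$ is proportional to $F_\xi^{(\{e\},\pi)}\Psi$, $$t\;\ge\; c\cdot\min\{\operatorname{dist}(v_0,v_1),\,m,\,n\},$$ where $\operatorname{dist}$ is the graph distance of the lattice. -/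

import Mathlib

open scoped Matrix

noncomputable section

namespace QuantumDouble

/-! ### The planar square lattice with `m × n` plaquettes -/

/-- Vertices: the integer points of `[0, m] × [0, n]`. -/
abbrev Vertex (m n : ℕ) : Type := Fin (m + 1) × Fin (n + 1)

/-- Plaquettes: `(a, b)` is the unit square with lower left corner `(a, b)`. -/
abbrev Plaquette (m n : ℕ) : Type := Fin m × Fin n

/-- Edges: `inl (i, j)` is the horizontal edge from `(i, j)` to `(i + 1, j)`, and
`inr (i, j)` is the vertical edge from `(i, j)` to `(i, j + 1)`. -/
abbrev Edge (m n : ℕ) : Type := (Fin m × Fin (n + 1)) ⊕ (Fin (m + 1) × Fin n)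

/-- The left (lower) endpoint of a horizontal (vertical) edge. -/
def Edge.low {m n : ℕ} : Edge m n → Vertex m n
  | Sum.inl (i, j) => (i.castSucc, j)
  | Sum.inr (i, j) => (i, j.castSucc)

/-- The right (upper) endpoint of a horizontal (vertical) edge. -/
def Edge.high {m n : ℕ} : Edge m n → Vertex m n
  | Sum.inl (i, j) => (i.succ, j)
  | Sum.inr (i, j) => (i, j.succ)

/-- An orientation of the edges: `true` means that the arrow points to the right (upwards),
that is, from `low` to `high`. -/
abbrev Orientation (m n : ℕ) : Type := Edge m n → Bool

def Orientation.tail {m n : ℕ} (o : Orientation m n) (e : Edge m n) : Vertex m n :=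
  if o e then Edge.low e else Edge.high e

def Orientation.head {m n : ℕ} (o : Orientation m n) (e : Edge m n) : Vertex m n :=
  if o e then Edge.high e else Edge.low e

/-- The graph distance of two vertices of the square lattice. -/
def vertexDist {m n : ℕ} (v w : Vertex m n) : ℕ :=
  Nat.dist (v.1 : ℕ) (w.1 : ℕ) + Nat.dist (v.2 : ℕ) (w.2 : ℕ)

/-- A site `(v, p)`: a plaquette `p` together with one of its four corners `v`. The corners are
numbered counterclockwise, starting with the lower left one. -/
@[ext]
structure Site (m n : ℕ) where
  plaquette : Plaquette m n
  corner : Fin 4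

/-- The vertex of a site. -/
def Site.vertex {m n : ℕ} (s : Site m n) : Vertex m n :=
  match s.corner with
  | 0 => (s.plaquette.1.castSucc, s.plaquette.2.castSucc)
  | 1 => (s.plaquette.1.succ, s.plaquette.2.castSucc)
  | 2 => (s.plaquette.1.succ, s.plaquette.2.succ)
  | 3 => (s.plaquette.1.castSucc, s.plaquette.2.succ)

/-- For a site `s = (v, p)`, the edge of `p` that leads from `v` to the next corner of `p` in
clockwise direction. -/
def Site.edge {m n : ℕ} (s : Site m n) : Edge m n :=
  match s.corner with
  | 0 => Sum.inr (s.plaquette.1.castSucc, s.plaquette.2)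
  | 1 => Sum.inl (s.plaquette.1, s.plaquette.2.castSucc)
  | 2 => Sum.inr (s.plaquette.1.succ, s.plaquette.2)
  | 3 => Sum.inl (s.plaquette.1, s.plaquette.2.succ)

/-- The direction in which `Site.edge` is traversed away from the vertex of the site: `true` if
it is traversed to the right or upwards. -/
def Site.dir {m n : ℕ} (s : Site m n) : Bool :=
  match s.corner with
  | 0 => true
  | 1 => false
  | 2 => false
  | 3 => true

/-! ### States and operators -/

/-- Computational basis states: a group element on every edge. -/
abbrev Config (m n : ℕ) (G : Type*) : Type _ := Edge m n → G

/-- (Unnormalized) state vectors of the qudits, in the computational basis. -/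
abbrev State (m n : ℕ) (G : Type*) : Type _ := Config m n G → ℂ

/-- Operators on the qudits, as matrices in the computational basis. -/
abbrev Op (m n : ℕ) (G : Type*) : Type _ := Matrix (Config m n G) (Config m n G) ℂ

section Operators

variable {m n : ℕ} {G : Type*} [Group G] [Fintype G] [DecidableEq G]

/-- The operator `|ω⟩ ↦ |f ω⟩`. -/
def basisMap (f : Config m n G → Config m n G) : Op m n G :=
  Matrix.of fun ω' ω => if ω' = f ω then 1 else 0

/-- The diagonal projection onto the basis states satisfying `P`. -/
def basisProj (P : Config m n G → Prop) [DecidablePred P] : Op m n G :=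
  Matrix.diagonal fun ω => if P ω then 1 else 0

/-- The group element read along `Site.edge`, in the direction leading away from the vertex of
the site; it is inverted if this is against the arrow of the edge. -/
def readEdge (o : Orientation m n) (s : Site m n) (ω : Config m n G) : G :=
  if s.dir = o s.edge then ω s.edge else (ω s.edge)⁻¹

/-- The effect on a basis state of left multiplication by `h` of the group element
`readEdge o s`. -/
def mulEdge (o : Orientation m n) (s : Site m n) (h : G) (ω : Config m n G) : Config m n G :=
  Function.update ω s.edge
    (if s.dir = o s.edge then h * ω s.edge else ω s.edge * h⁻¹)

/-- The operator `A_v^g`: the gauge transformation by `g` at the vertex `v`. -/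
def vertexOpAt (o : Orientation m n) (v : Vertex m n) (g : G) : Op m n G :=
  basisMap fun ω e =>
    (if o.tail e = v then g else 1) * ω e * (if o.head e = v then g⁻¹ else 1)

/-- The product of the group elements around the plaquette of the site `s`, traversed
counterclockwise from the vertex of `s`. -/
def flux (o : Orientation m n) (s : Site m n) (ω : Config m n G) : G :=
  (readEdge o ⟨s.plaquette, s.corner + 1⟩ ω)⁻¹ * (readEdge o ⟨s.plaquette, s.corner + 2⟩ ω)⁻¹ *
    (readEdge o ⟨s.plaquette, s.corner + 3⟩ ω)⁻¹ * (readEdge o s ω)⁻¹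

/-- The site operator `A_s^g`. -/
def siteA (o : Orientation m n) (s : Site m n) (g : G) : Op m n G :=
  vertexOpAt o s.vertex g

/-- The site operator `B_s^h`. -/
def siteB (o : Orientation m n) (s : Site m n) (h : G) : Op m n G :=
  basisProj fun ω => flux o s ω = h

/-- The vertex operator `A_v = |G|⁻¹ ∑_g A_v^g`. -/
def vertexOp (o : Orientation m n) (v : Vertex m n) : Op m n G :=
  (Fintype.card G : ℂ)⁻¹ • ∑ g : G, vertexOpAt o v g

/-- The plaquette operator `B_p = B_s^e`, where `s` is any site with plaquette `p`. -/
def plaquetteOp (o : Orientation m n) (p : Plaquette m n) : Op m n G :=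
  siteB o ⟨p, 0⟩ 1

variable (G) in
/-- The quantum double Hamiltonian `H = - ∑_v A_v - ∑_p B_p`. -/
def hamiltonian (o : Orientation m n) : Op m n G :=
  -(∑ v : Vertex m n, vertexOp o v) - ∑ p : Plaquette m n, plaquetteOp o p

/-- `Ψ` is a ground state: a nonzero eigenvector of `H` for the smallest eigenvalue. -/
def IsGroundState (o : Orientation m n) (Ψ : State m n G) : Prop :=
  Ψ ≠ 0 ∧ ∃ E : ℝ, hamiltonian G o *ᵥ Ψ = (E : ℂ) • Ψ ∧
    ∀ (E' : ℝ) (Φ : State m n G), Φ ≠ 0 → hamiltonian G o *ᵥ Φ = (E' : ℂ) • Φ → E ≤ E'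

end Operators

/-! ### Ribbons and ribbon operators -/

/-- The two kinds of triangles of a ribbon. -/
inductive TriangleKind
  | primary
  | dual

/-- A triangle of a ribbon, given by its kind and its starting site `s = (v, p)`.
The primary triangle consists of `Site.edge s` and `p`; it leads to the other endpoint of this
edge, at the same plaquette. The dual triangle consists of `Site.edge s` and `v`; it crosses this
edge and leads to the plaquette on its other side, at the same vertex. -/
structure Triangle (m n : ℕ) where
  kind : TriangleKind
  source : Site m n

/-- `t` is the final site of the triangle `τ`. A primary triangle moves to the next corner of the
same plaquette in clockwise direction. A dual triangle moves to the next plaquette at the same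
vertex in counterclockwise direction; this requires that there is a plaquette on the other side of
the edge that is crossed. -/
def Triangle.EndsAt {m n : ℕ} (τ : Triangle m n) (t : Site m n) : Prop :=
  match τ.kind with
  | TriangleKind.primary =>
      t.plaquette = τ.source.plaquette ∧ t.corner = τ.source.corner - 1
  | TriangleKind.dual => t.vertex = τ.source.vertex ∧ t.corner = τ.source.corner + 1

/-- Two triangles do not overlap. Triangles of the same kind overlap only if they are equal, and
triangles of different kinds overlap if and only if they have the same edge. -/
def Triangle.NonOverlapping {m n : ℕ} (τ τ' : Triangle m n) : Prop :=
  τ ≠ τ' ∧ (τ.kind ≠ τ'.kind → τ.source.edge ≠ τ'.source.edge)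

/-- `IsStrip s l t`: the triangles of the list `l` lead contiguously from the site `s` to the
site `t`. -/
inductive IsStrip {m n : ℕ} : Site m n → List (Triangle m n) → Site m n → Prop
  | nil (s : Site m n) : IsStrip s [] s
  | cons (τ : Triangle m n) (u t : Site m n) (l : List (Triangle m n)) :
      τ.EndsAt u → IsStrip u l t → IsStrip τ.source (τ :: l) t

/-- `ξ` is an open ribbon from the site `s₀` to the (distinct) site `s₁`: a contiguous sequence of
triangles which does not overlap itself. -/
def IsOpenRibbon {m n : ℕ} (s₀ : Site m n) (ξ : List (Triangle m n)) (s₁ : Site m n) : Prop :=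
  s₀ ≠ s₁ ∧ IsStrip s₀ ξ s₁ ∧ ξ.Pairwise Triangle.NonOverlapping

section RibbonOperators

variable {m n : ℕ} {G : Type*} [Group G] [Fintype G] [DecidableEq G]

/-- The ribbon operator `F_τ^{h,g}` of a single triangle: the projection onto `y = g` for a primary
triangle along whose edge `y` is read, and `δ_{g,e}` times the multiplication `x ↦ h x` for a dual
triangle crossing an edge with group element `x` (read in the direction away from the vertex of
the triangle). -/
def triangleOp (o : Orientation m n) (τ : Triangle m n) (h g : G) : Op m n G :=
  match τ.kind with
  | TriangleKind.primary => basisProj fun ω => readEdge o τ.source ω = g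
  | TriangleKind.dual => if g = 1 then basisMap (mulEdge o τ.source h) else 0

/-- The basic ribbon operator `F_ξ^{h,g}`, by the co-multiplication rule
`F_{τξ}^{h,g} = ∑_k F_τ^{h,k} F_ξ^{k⁻¹hk, k⁻¹g}`. On a ribbon along whose primary triangles one
reads `y₁, y₂, …` it is the projection onto `y₁ y₂ ⋯ = g`, together with the multiplication
`x ↦ (y₁ ⋯ y_j)⁻¹ h (y₁ ⋯ y_j) x` on every edge crossed by a dual triangle which is preceded by
exactly `j` primary ones. -/
def ribbonOp (o : Orientation m n) : List (Triangle m n) → G → G → Op m n G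
  | [], _, g => if g = 1 then 1 else 0
  | τ :: ξ, h, g => ∑ k : G, triangleOp o τ h k * ribbonOp o ξ (k⁻¹ * h * k) (k⁻¹ * g)

open scoped Classical in
/-- The anyonic ribbon operator `F_ξ^{(C,π);(u,v)}` for the conjugacy class `C` of `r`, a unitary
representation `Γ` of the centralizer `E(C)` of `r` of dimension `d`, and `u = (i, j)`,
`v = (i', j')`. Here the indices `i, i'` are replaced by the coset representatives
`p = p_i`, `p' = p_{i'}` that they stand for, so that `c_i = p r p⁻¹`. -/
def anyonicRibbonOpAt (o : Orientation m n) (ξ : List (Triangle m n)) (r : G) {d : ℕ}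
    (Γ : Subgroup.centralizer ({r} : Set G) →* Matrix.unitaryGroup (Fin d) ℂ)
    (p : G) (j : Fin d) (p' : G) (j' : Fin d) : Op m n G :=
  ((d : ℂ) / (Nat.card (Subgroup.centralizer ({r} : Set G)) : ℂ)) •
    ∑ k : Subgroup.centralizer ({r} : Set G),
      (((Γ k)⁻¹ : Matrix.unitaryGroup (Fin d) ℂ) : Matrix (Fin d) (Fin d) ℂ) j j' •
        ribbonOp o ξ (p * r * p⁻¹)⁻¹ (p * (k : G) * p'⁻¹)

/-- The anyonic ribbon operator `F_ξ^{(C,π)} = F_ξ^{(C,π);((1,1),(1,1))}`. -/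
def anyonicRibbonOp (o : Orientation m n) (ξ : List (Triangle m n)) (r : G) {d : ℕ} [NeZero d]
    (Γ : Subgroup.centralizer ({r} : Set G) →* Matrix.unitaryGroup (Fin d) ℂ) : Op m n G :=
  anyonicRibbonOpAt o ξ r Γ 1 0 1 0

end RibbonOperators

/-! ### Irreducible unitary representations -/

/-- The representation on `ℂ^d` given by a homomorphism to the unitary matrices. -/
def matrixRep {G : Type*} [Group G] {d : ℕ} (Γ : G →* Matrix.unitaryGroup (Fin d) ℂ) :
    Representation ℂ G (Fin d → ℂ) :=
  ((Matrix.toLinAlgEquiv' : Matrix (Fin d) (Fin d) ℂ ≃ₐ[ℂ] ((Fin d → ℂ) →ₗ[ℂ] (Fin d → ℂ))) :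
      Matrix (Fin d) (Fin d) ℂ →* ((Fin d → ℂ) →ₗ[ℂ] (Fin d → ℂ))).comp
    ((Matrix.unitaryGroup (Fin d) ℂ).subtype.comp Γ)

/-! ### Local unitary circuits -/

section Circuits

variable {m n : ℕ} {G : Type*}

/-- The operator `M` acts only on the qudits in `S`: it is of the form `N ⊗ 1`. -/
def IsSupportedOn (M : Op m n G) (S : Finset (Edge m n)) : Prop :=
  ∃ N : Matrix (S → G) (S → G) ℂ, ∀ ω' ω : Config m n G,
    ((∀ e ∉ S, ω' e = ω e) → M ω' ω = N (fun e => ω' e) (fun e => ω e)) ∧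
    ((∃ e ∉ S, ω' e ≠ ω e) → M ω' ω = 0)

/-- The set `S` of qudits has range at most `R`: any two endpoints of its edges have graph
distance at most `R`. -/
def HasRange (R : ℕ) (S : Finset (Edge m n)) : Prop :=
  ∀ e ∈ S, ∀ f ∈ S, ∀ v w : Vertex m n,
    (v = Edge.low e ∨ v = Edge.high e) → (w = Edge.low f ∨ w = Edge.high f) → vertexDist v w ≤ R

variable [Fintype G] [DecidableEq G]

/-- One layer of a local circuit: a product of unitary gates of range at most `R` which act on
pairwise disjoint sets of qudits. -/
def IsLayer (R : ℕ) (U : Op m n G) : Prop :=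
  ∃ (k : ℕ) (S : Fin k → Finset (Edge m n)) (g : Fin k → Op m n G),
    Pairwise (fun i j => Disjoint (S i) (S j)) ∧
    (∀ i, HasRange R (S i) ∧ g i ∈ Matrix.unitaryGroup (Config m n G) ℂ ∧
      IsSupportedOn (g i) (S i)) ∧
    U = (List.ofFn g).prod

/-- `U` is realized by a local unitary circuit of depth `t` with gates of range at most `R`. -/
def IsLocalCircuit (R t : ℕ) (U : Op m n G) : Prop :=
  ∃ l : List (Op m n G), l.length = t ∧ (∀ V ∈ l, IsLayer R V) ∧ U = l.prod

end Circuits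

end QuantumDouble

end

/-! Since the uniform superposition of flat configurations (those gauge equivalent to `1`) is fixed
by every term of `H`, every ground state `Ψ` is fixed by all of them, and simple connectedness makes
it a multiple of this superposition (`IsGroundState.isFlatState`). A fluxless ribbon operator is
diagonal and depends only on the holonomy from `v₀` to `v₁`, so `Φ = F Ψ` has amplitude `f g` on
flat configurations of holonomy `g`, with `f g` proportional to a diagonal entry of `Γ(g)⁻¹`. If a
commutator acts nontrivially in the irreducible `Γ`, no basis vector is a common eigenvector, so
`|f|` is not constant, while it is maximal at `1`. It thus suffices that a shallow circuit taking
`Ψ` to a multiple of `Φ` forces `|G| |f g|² ≤ ∑ |f h|²`; this is `Frame.card_mul_norm_le`.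

To prove the inequality, let `χ = P Φ` be the component of `Φ` whose holonomy along an arch through
the top row is `g`. Closed dual strings along a column between the endpoints fix `Ψ`, so their
conjugates `X h` under `U` fix `Φ`. Every `X h χ` has inner product `‖χ‖²` with `Φ`; if these
vectors are orthogonal, a Bessel inequality gives `|G| ‖χ‖² ≤ ‖Φ‖²`, which is the claim.

For orthogonality, let `Q k` be the conjugated projections onto the values of the holonomy along a
segment of the bottom row. The string changes this holonomy, so `Q k * X h * Q k = 0` for `h ≠ 1`.
What must be shown is that `⟨χ, X h χ⟩` is the sum of the `⟨Q k χ, X h (Q k χ)⟩`. Now `χ` is flat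
and gauge invariant in the upper part of the strip that supports `X h`, and its arch holonomy is
fixed. On such states `X h` has the same expectation as an operator `Y` on the lower part of the
strip (`Frame.exists_suppOn_lowStrip`). On `χ` the projection `Q k` acts like one defined by a
detour above that lower part, which commutes with `Y`. Finally `Q k χ` has the same properties as
`χ`, because `Q k` lives near the bottom row, so `Y` may be turned back into `X h`. -/

noncomputable section

namespace QuantumDouble

/-! ### Operators supported on sets of edges -/

section Support

variable {m n : ℕ} {G : Type*} [Group G]

/-- `M` acts only on the qudits in `S`, expressed by matrix elements: they vanish between
configurations that differ off `S`, and are invariant under common changes off `S`. -/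
def SuppOn (M : Op m n G) (S : Set (Edge m n)) : Prop :=
  (∀ ω' ω : Config m n G, (∃ e ∉ S, ω' e ≠ ω e) → M ω' ω = 0) ∧
    ∀ c : Config m n G, (∀ e ∈ S, c e = 1) → ∀ ω' ω, M (c * ω') (c * ω) = M ω' ω

/-- Left multiplication by a configuration that is `1` on `S` carries one pair to the other. -/
theorem SuppOn.congr {M : Op m n G} {S : Set (Edge m n)} (h : SuppOn M S)
    {ω' ω η' η : Config m n G} (h₁ : ∀ e ∉ S, ω' e = ω e) (h₂ : ∀ e ∉ S, η' e = η e)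
    (h₃ : ∀ e ∈ S, ω' e = η' e) (h₄ : ∀ e ∈ S, ω e = η e) : M ω' ω = M η' η := by
  classical
  let c : Config m n G := fun e => if e ∈ S then 1 else η e * (ω e)⁻¹
  have hc : ∀ e ∈ S, c e = 1 := fun e he => by simp [c, he]
  rw [← h.2 c hc ω' ω]
  congr 1
  · funext e
    by_cases he : e ∈ S
    · simp [c, he, h₃ e he]
    · simp [c, he, h₁ e he, h₂ e he]
  · funext e
    by_cases he : e ∈ S
    · simp [c, he, h₄ e he]
    · simp [c, he]

theorem SuppOn.mono {M : Op m n G} {S T : Set (Edge m n)} (h : SuppOn M S) (hST : S ⊆ T) :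
    SuppOn M T :=
  ⟨fun ω' ω ⟨e, he, hne⟩ => h.1 ω' ω ⟨e, fun h' => he (hST h'), hne⟩,
    fun c hc => h.2 c fun e he => hc e (hST he)⟩

theorem suppOn_of_isSupportedOn {M : Op m n G} {S : Finset (Edge m n)}
    (h : IsSupportedOn M S) : SuppOn M (S : Set (Edge m n)) := by
  obtain ⟨N, hN⟩ := h
  refine ⟨fun ω' ω ⟨e, he, hne⟩ => (hN ω' ω).2 ⟨e, by simpa using he, hne⟩, fun c hc ω' ω => ?_⟩
  by_cases hd : ∀ e ∉ S, ω' e = ω e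
  · rw [(hN ω' ω).1 hd, (hN (c * ω') (c * ω)).1 fun e he => by simp [hd e he]]
    congr 1 <;> funext e <;> simp [hc e (by simp)]
  · push Not at hd
    obtain ⟨e, he, hne⟩ := hd
    rw [(hN ω' ω).2 ⟨e, he, hne⟩, (hN (c * ω') (c * ω)).2 ⟨e, he, by simpa using hne⟩]

variable [Fintype G]

omit [Fintype G] in
theorem SuppOn.conjTranspose {M : Op m n G} {S : Set (Edge m n)} (h : SuppOn M S) :
    SuppOn Mᴴ S :=
  ⟨fun ω' ω ⟨e, he, hne⟩ => by
      rw [Matrix.conjTranspose_apply, h.1 ω ω' ⟨e, he, hne.symm⟩, star_zero],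
    fun c hc ω' ω => by simp only [Matrix.conjTranspose_apply, h.2 c hc]⟩

theorem SuppOn.mul {M N : Op m n G} {S : Set (Edge m n)} (hM : SuppOn M S) (hN : SuppOn N S) :
    SuppOn (M * N) S := by
  classical
  refine ⟨fun ω' ω ⟨e, he, hne⟩ => ?_, fun c hc ω' ω => ?_⟩
  · rw [Matrix.mul_apply]
    refine Finset.sum_eq_zero fun η _ => ?_
    by_cases h : ω' e = η e
    · rw [hN.1 η ω ⟨e, he, by rwa [← h]⟩, mul_zero]
    · rw [hM.1 ω' η ⟨e, he, h⟩, zero_mul]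
  · rw [Matrix.mul_apply, Matrix.mul_apply, ← Equiv.sum_comp (Equiv.mulLeft c)]
    simp [hM.2 c hc, hN.2 c hc]

/-- Only one intermediate configuration can contribute to each product: for `M * N` it is `ω` on `S`
and `ω'` elsewhere, for `N * M` it is `ω` on `T` and `ω'` elsewhere. The resulting factors agree by
`SuppOn.congr`. -/
theorem SuppOn.commute {M N : Op m n G} {S T : Set (Edge m n)} (hM : SuppOn M S)
    (hN : SuppOn N T) (hST : Disjoint S T) : Commute M N := by
  classical
  rw [Set.disjoint_left] at hST
  ext ω' ω
  rw [Matrix.mul_apply, Matrix.mul_apply]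
  by_cases hd : ∀ e, e ∉ S → e ∉ T → ω' e = ω e
  · let η₀ : Config m n G := fun e => if e ∈ S then ω e else ω' e
    let η₁ : Config m n G := fun e => if e ∈ T then ω e else ω' e
    rw [Finset.sum_eq_single η₀, Finset.sum_eq_single η₁, mul_comm]
    · congr 1
      · refine hN.congr (fun e he => ?_) (fun e he => ?_) (fun e he => ?_) (fun e he => ?_)
        · by_cases h : e ∈ S
          · simp [η₀, h]
          · simp [η₀, h, hd e h he]
        · simp [η₁, he]
        · have : e ∉ S := fun h => hST h he
          simp [η₀, this]
        · simp [η₁, he]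
      · refine hM.congr (fun e he => ?_) (fun e he => ?_) (fun e he => ?_) (fun e he => ?_)
        · simp [η₀, he]
        · by_cases h : e ∈ T
          · simp [η₁, h]
          · simp [η₁, h, hd e he h]
        · have : e ∉ T := fun h => hST he h
          simp [η₁, this]
        · simp [η₀, he]
    · intro η _ hη
      obtain ⟨e, he⟩ := Function.ne_iff.mp hη
      by_cases h : e ∈ T
      · rw [hM.1 η ω ⟨e, fun h' => hST h' h, by simpa [η₁, h] using he⟩, mul_zero]
      · rw [hN.1 ω' η ⟨e, h, by simpa [η₁, h] using he.symm⟩, zero_mul]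
    · simp
    · intro η _ hη
      obtain ⟨e, he⟩ := Function.ne_iff.mp hη
      by_cases h : e ∈ S
      · rw [hN.1 η ω ⟨e, fun h' => hST h h', by simpa [η₀, h] using he⟩, mul_zero]
      · rw [hM.1 ω' η ⟨e, h, by simpa [η₀, h] using he.symm⟩, zero_mul]
    · simp
  · push Not at hd
    obtain ⟨e, hS, hT, hne⟩ := hd
    rw [Finset.sum_eq_zero, Finset.sum_eq_zero]
    · intro η _
      by_cases h : ω' e = η e
      · rw [hM.1 η ω ⟨e, hS, by rwa [← h]⟩, mul_zero]
      · rw [hN.1 ω' η ⟨e, hT, h⟩, zero_mul]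
    · intro η _
      by_cases h : ω' e = η e
      · rw [hN.1 η ω ⟨e, hT, by rwa [← h]⟩, mul_zero]
      · rw [hM.1 ω' η ⟨e, hS, h⟩, zero_mul]

variable [DecidableEq G]

omit [Fintype G] in
theorem suppOn_basisProj {P : Config m n G → Prop} [DecidablePred P] {S : Set (Edge m n)}
    (h : ∀ ω ω' : Config m n G, (∀ e ∈ S, ω e = ω' e) → P ω → P ω') :
    SuppOn (basisProj P) S := by
  refine ⟨fun ω' ω ⟨e, _, hne⟩ => Matrix.diagonal_apply_ne _ fun h' => hne (congrFun h' e),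
    fun c hc ω' ω => ?_⟩
  have hiff : P (c * ω') ↔ P ω' :=
    ⟨h _ _ fun e he => by simp [hc e he], h _ _ fun e he => by simp [hc e he]⟩
  simp only [basisProj, Matrix.diagonal_apply, mul_right_inj, hiff]

omit [Fintype G] in
theorem suppOn_basisMap {f : Config m n G → Config m n G} {S : Set (Edge m n)}
    (h : ∀ ω, ∀ e ∉ S, f ω e = ω e)
    (h' : ∀ ω ω' : Config m n G, (∀ e ∈ S, ω e = ω' e) → ∀ e ∈ S, f ω e = f ω' e) :
    SuppOn (basisMap f) S := by
  refine ⟨fun ω' ω ⟨e, he, hne⟩ => ?_, fun c hc ω' ω => ?_⟩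
  · rw [basisMap, Matrix.of_apply, if_neg]
    rintro rfl
    exact hne (h ω e he)
  · have : f (c * ω) = c * f ω := by
      funext e
      by_cases he : e ∈ S
      · rw [h' (c * ω) ω (fun e he => by simp [hc e he]) e he]
        simp [hc e he]
      · simp [h _ e he]
    simp [basisMap, Matrix.of_apply, this]

/-! ### Spreading of supports under local circuits -/

/-- The edges at distance at most `r` from the set `A`, measured between lower endpoints. -/
def nbhd (r : ℕ) (A : Set (Edge m n)) : Set (Edge m n) :=
  {e | ∃ f ∈ A, vertexDist (Edge.low e) (Edge.low f) ≤ r}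

theorem vertexDist_self (v : Vertex m n) : vertexDist v v = 0 := by
  simp [vertexDist]

theorem vertexDist_triangle (u v w : Vertex m n) :
    vertexDist u w ≤ vertexDist u v + vertexDist v w := by
  have := Nat.dist.triangle_inequality (u.1 : ℕ) (v.1 : ℕ) (w.1 : ℕ)
  have := Nat.dist.triangle_inequality (u.2 : ℕ) (v.2 : ℕ) (w.2 : ℕ)
  simp only [vertexDist]
  omega

theorem nbhd_nbhd_subset (r s : ℕ) (A : Set (Edge m n)) : nbhd r (nbhd s A) ⊆ nbhd (r + s) A := by
  rintro e ⟨f, ⟨g, hg, hfg⟩, hef⟩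
  exact ⟨g, hg, (vertexDist_triangle _ _ _).trans (add_le_add hef hfg)⟩

theorem subset_nbhd (r : ℕ) (A : Set (Edge m n)) : A ⊆ nbhd r A :=
  fun e he => ⟨e, he, by simp [vertexDist_self]⟩

/-- Only gates that meet the original support `A` enlarge it. A gate that misses `A` also misses the
gates absorbed so far, since the gates are disjoint; it therefore commutes with the conjugated
operator and cancels against its adjoint. -/
theorem suppOn_conj_prod {ι : Type*} [DecidableEq ι] (S : ι → Finset (Edge m n))
    (g : ι → Op m n G) (hS : Pairwise fun i j => Disjoint (S i) (S j))
    (hg : ∀ i, g i ∈ Matrix.unitaryGroup (Config m n G) ℂ) (hs : ∀ i, IsSupportedOn (g i) (S i))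
    {O : Op m n G} {A : Set (Edge m n)} (hO : SuppOn O A) (l : List ι) (hl : l.Nodup) :
    SuppOn ((l.map g).prod * O * ((l.map g).prod)ᴴ)
      (A ∪ {e | ∃ i ∈ l, e ∈ S i ∧ ∃ f ∈ S i, f ∈ A}) := by
  induction l with
  | nil => simpa using hO
  | cons i l ih =>
    rw [List.nodup_cons] at hl
    have ih := ih hl.2
    set B := A ∪ {e | ∃ i ∈ l, e ∈ S i ∧ ∃ f ∈ S i, f ∈ A}
    set Q := (l.map g).prod * O * ((l.map g).prod)ᴴ
    have hsub : B ⊆ A ∪ {e | ∃ j ∈ i :: l, e ∈ S j ∧ ∃ f ∈ S j, f ∈ A} := by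
      rintro e (he | ⟨j, hj, h⟩)
      · exact Or.inl he
      · exact Or.inr ⟨j, List.mem_cons_of_mem _ hj, h⟩
    have hprod : ((i :: l).map g).prod * O * (((i :: l).map g).prod)ᴴ = g i * Q * (g i)ᴴ := by
      simp [Q, Matrix.conjTranspose_mul, mul_assoc]
    rw [hprod]
    have hi := suppOn_of_isSupportedOn (hs i)
    by_cases hA : ∃ f ∈ S i, f ∈ A
    · have hsub' : (S i : Set (Edge m n)) ⊆ A ∪ {e | ∃ j ∈ i :: l, e ∈ S j ∧ ∃ f ∈ S j, f ∈ A} :=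
        fun e he => Or.inr ⟨i, List.mem_cons_self, he, hA⟩
      exact ((hi.mono hsub').mul (ih.mono hsub)).mul (hi.mono hsub').conjTranspose
    · have hdis : Disjoint (S i : Set (Edge m n)) B := by
        rw [Set.disjoint_left]
        rintro e he (h | ⟨j, hj, hej, -⟩)
        · exact hA ⟨e, he, h⟩
        · have hij : i ≠ j := by
            rintro rfl
            exact hl.1 hj
          exact Finset.disjoint_left.mp (hS hij) he hej
      have hc := hi.commute ih hdis
      rw [hc.eq, mul_assoc, ← Matrix.star_eq_conjTranspose,
        Matrix.mem_unitaryGroup_iff.mp (hg i), mul_one]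
      exact ih.mono hsub

omit [Group G] in
theorem IsLayer.mem_unitaryGroup {R : ℕ} {V : Op m n G} (h : IsLayer R V) :
    V ∈ Matrix.unitaryGroup (Config m n G) ℂ := by
  obtain ⟨k, S, g, -, hg, rfl⟩ := h
  refine Submonoid.list_prod_mem _ fun x hx => ?_
  obtain ⟨i, rfl⟩ := List.mem_ofFn.mp hx
  exact (hg i).2.1

theorem IsLayer.suppOn_conj {R : ℕ} {V : Op m n G} (h : IsLayer R V) {O : Op m n G}
    {A : Set (Edge m n)} (hO : SuppOn O A) : SuppOn (V * O * Vᴴ) (nbhd R A) := by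
  obtain ⟨k, S, g, hS, hg, rfl⟩ := h
  rw [List.ofFn_eq_map]
  refine (suppOn_conj_prod S g hS (fun i => (hg i).2.1) (fun i => (hg i).2.2) hO _
    (List.nodup_finRange k)).mono ?_
  rintro e (he | ⟨i, -, he, f, hf, hfA⟩)
  · exact subset_nbhd R A he
  · exact ⟨f, hfA, (hg i).1 e he f hf _ _ (Or.inl rfl) (Or.inl rfl)⟩

omit [Group G] in
theorem IsLocalCircuit.mem_unitaryGroup {R t : ℕ} {U : Op m n G} (h : IsLocalCircuit R t U) :
    U ∈ Matrix.unitaryGroup (Config m n G) ℂ := by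
  obtain ⟨l, -, hl, rfl⟩ := h
  exact Submonoid.list_prod_mem _ fun x hx => (hl x hx).mem_unitaryGroup

theorem IsLocalCircuit.suppOn_conj {R t : ℕ} {U : Op m n G} (h : IsLocalCircuit R t U)
    {O : Op m n G} {A : Set (Edge m n)} (hO : SuppOn O A) :
    SuppOn (U * O * Uᴴ) (nbhd (R * t) A) := by
  obtain ⟨l, rfl, hl, rfl⟩ := h
  induction l with
  | nil => simpa using hO.mono (subset_nbhd 0 A)
  | cons V l ih =>
    have h := (hl V List.mem_cons_self).suppOn_conj
      (ih fun W hW => hl W (List.mem_cons_of_mem _ hW))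
    have heq : (V :: l).prod * O * ((V :: l).prod)ᴴ = V * (l.prod * O * (l.prod)ᴴ) * Vᴴ := by
      simp [Matrix.conjTranspose_mul, mul_assoc]
    rw [heq]
    refine h.mono ((nbhd_nbhd_subset _ _ _).trans_eq ?_)
    rw [List.length_cons, Nat.mul_succ, add_comm]

end Support

/-! ### Gauge transformations -/

section Gauge

variable {m n : ℕ} {G : Type*} [Group G]

/-- The gauge transformation of a configuration by a group element at every vertex. -/
def gauge (o : Orientation m n) (u : Vertex m n → G) (ω : Config m n G) : Config m n G :=
  fun e => u (o.tail e) * ω e * (u (o.head e))⁻¹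

/-- The group element on `e`, read from the lower to the higher endpoint. -/
def upRead (o : Orientation m n) (e : Edge m n) (ω : Config m n G) : G :=
  if o e then ω e else (ω e)⁻¹

theorem upRead_gauge (o : Orientation m n) (e : Edge m n) (u : Vertex m n → G)
    (ω : Config m n G) :
    upRead o e (gauge o u ω) = u (Edge.low e) * upRead o e ω * (u (Edge.high e))⁻¹ := by
  by_cases h : o e = true <;>
    simp [upRead, gauge, Orientation.tail, Orientation.head, h, mul_assoc]

theorem upRead_inj {o : Orientation m n} {e : Edge m n} {ω ω' : Config m n G} :
    upRead o e ω = upRead o e ω' ↔ ω e = ω' e := by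
  by_cases h : o e = true <;> simp [upRead, h]

theorem upRead_one (o : Orientation m n) (e : Edge m n) : upRead o e (1 : Config m n G) = 1 := by
  simp [upRead]

theorem gauge_mul (o : Orientation m n) (u u' : Vertex m n → G) (ω : Config m n G) :
    gauge o (u * u') ω = gauge o u (gauge o u' ω) := by
  funext e
  simp [gauge, mul_assoc]

theorem gauge_one (o : Orientation m n) (ω : Config m n G) : gauge o 1 ω = ω := by
  funext e
  simp [gauge]

/-- Gauge transformations as permutations of the configurations. -/
def gaugeEquiv (o : Orientation m n) (u : Vertex m n → G) : Config m n G ≃ Config m n G where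
  toFun := gauge o u
  invFun := gauge o u⁻¹
  left_inv ω := by rw [← gauge_mul, inv_mul_cancel, gauge_one]
  right_inv ω := by rw [← gauge_mul, mul_inv_cancel, gauge_one]

theorem gauge_apply_congr (o : Orientation m n) (u : Vertex m n → G) {ω ω' : Config m n G}
    {e : Edge m n} : gauge o u ω e = gauge o u ω' e ↔ ω e = ω' e := by
  simp [gauge]

theorem gauge_apply_of_eq_one {o : Orientation m n} {u : Vertex m n → G} {e : Edge m n}
    (h₁ : u (Edge.low e) = 1) (h₂ : u (Edge.high e) = 1) (ω : Config m n G) :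
    gauge o u ω e = ω e := by
  rw [← upRead_inj (o := o), upRead_gauge, h₁, h₂]
  simp

/-- The configuration `gauge o φ 1` determines `φ` along an edge up to right multiplication. -/
theorem inv_mul_eq_of_gauge_eq {o : Orientation m n} {φ φ' : Vertex m n → G} {e : Edge m n}
    (h : gauge o φ 1 e = gauge o φ' 1 e) :
    (φ (Edge.low e))⁻¹ * φ' (Edge.low e) = (φ (Edge.high e))⁻¹ * φ' (Edge.high e) := by
  rw [← upRead_inj (o := o), upRead_gauge, upRead_gauge, upRead_one, mul_one, mul_one] at h
  rw [inv_mul_eq_iff_eq_mul, ← mul_assoc, h, inv_mul_cancel_right]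

/-- The gauge transformations at the vertices in `I`. -/
def gaugeOn (G : Type*) [Group G] (I : Set (Vertex m n)) : Subgroup (Vertex m n → G) where
  carrier := {u | ∀ v ∉ I, u v = 1}
  one_mem' := fun _ _ => rfl
  mul_mem' := fun ha hb v hv => by simp [ha v hv, hb v hv]
  inv_mem' := fun ha v hv => by simp [ha v hv]

end Gauge

/-! ### Coordinates -/

/-- A coordinate system on the lattice. It exhibits it as a square lattice with `M × N`
plaquettes, where the first coordinate may be horizontal or vertical. -/
structure Frame (m n : ℕ) where
  (M N : ℕ)
  pt : ℕ → ℕ → Vertex m n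
  x : Vertex m n → ℕ
  y : Vertex m n → ℕ
  he : ℕ → ℕ → Edge m n
  ve : ℕ → ℕ → Edge m n
  x_pt : ∀ i j, i ≤ M → j ≤ N → x (pt i j) = i
  y_pt : ∀ i j, i ≤ M → j ≤ N → y (pt i j) = j
  x_le : ∀ v, x v ≤ M
  y_le : ∀ v, y v ≤ N
  pt_xy : ∀ v, pt (x v) (y v) = v
  low_he : ∀ i j, i < M → j ≤ N → Edge.low (he i j) = pt i j
  high_he : ∀ i j, i < M → j ≤ N → Edge.high (he i j) = pt (i + 1) j
  low_ve : ∀ i j, i ≤ M → j < N → Edge.low (ve i j) = pt i j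
  high_ve : ∀ i j, i ≤ M → j < N → Edge.high (ve i j) = pt i (j + 1)
  exists_edge : ∀ e, (∃ i j, i < M ∧ j ≤ N ∧ e = he i j) ∨ ∃ i j, i ≤ M ∧ j < N ∧ e = ve i j
  x_le_add : ∀ v w, x v ≤ x w + vertexDist v w
  y_le_add : ∀ v w, y v ≤ y w + vertexDist v w

namespace Frame

variable {m n : ℕ} {G : Type*} [Group G] (F : Frame m n) (o : Orientation m n)

theorem edge_bounds (e : Edge m n) :
    F.x (Edge.low e) ≤ F.x (Edge.high e) ∧ F.x (Edge.high e) ≤ F.x (Edge.low e) + 1 ∧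
    F.y (Edge.low e) ≤ F.y (Edge.high e) ∧ F.y (Edge.high e) ≤ F.y (Edge.low e) + 1 := by
  obtain ⟨i, j, hi, hj, rfl⟩ | ⟨i, j, hi, hj, rfl⟩ := F.exists_edge e
  · rw [F.low_he i j hi hj, F.high_he i j hi hj, F.x_pt i j hi.le hj, F.y_pt i j hi.le hj,
      F.x_pt (i + 1) j hi hj, F.y_pt (i + 1) j hi hj]
    omega
  · rw [F.low_ve i j hi hj, F.high_ve i j hi hj, F.x_pt i j hi hj.le, F.y_pt i j hi hj.le,
      F.x_pt i (j + 1) hi hj, F.y_pt i (j + 1) hi hj]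
    omega

theorem x_low_he {i j : ℕ} (hi : i < F.M) (hj : j ≤ F.N) : F.x (Edge.low (F.he i j)) = i := by
  rw [F.low_he i j hi hj, F.x_pt i j hi.le hj]

theorem y_low_he {i j : ℕ} (hi : i < F.M) (hj : j ≤ F.N) : F.y (Edge.low (F.he i j)) = j := by
  rw [F.low_he i j hi hj, F.y_pt i j hi.le hj]

theorem x_high_he {i j : ℕ} (hi : i < F.M) (hj : j ≤ F.N) :
    F.x (Edge.high (F.he i j)) = i + 1 := by
  rw [F.high_he i j hi hj, F.x_pt _ j hi hj]

theorem x_low_ve {i j : ℕ} (hi : i ≤ F.M) (hj : j < F.N) : F.x (Edge.low (F.ve i j)) = i := by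
  rw [F.low_ve i j hi hj, F.x_pt i j hi hj.le]

theorem y_low_ve {i j : ℕ} (hi : i ≤ F.M) (hj : j < F.N) : F.y (Edge.low (F.ve i j)) = j := by
  rw [F.low_ve i j hi hj, F.y_pt i j hi hj.le]

theorem x_high_ve {i j : ℕ} (hi : i ≤ F.M) (hj : j < F.N) : F.x (Edge.high (F.ve i j)) = i := by
  rw [F.high_ve i j hi hj, F.x_pt i _ hi hj]

/-- The product of the group elements along the row `j`, from column `a` to `a + l`. -/
def rowProd (j a : ℕ) : ℕ → Config m n G → G
  | 0, _ => 1
  | l + 1, ω => rowProd j a l ω * upRead o (F.he (a + l) j) ω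

/-- The product of the group elements along the column `i`, from row `b` to `b + l`. -/
def colProd (i b : ℕ) : ℕ → Config m n G → G
  | 0, _ => 1
  | l + 1, ω => colProd i b l ω * upRead o (F.ve i (b + l)) ω

theorem rowProd_gauge {j a l : ℕ} (hl : a + l ≤ F.M) (hj : j ≤ F.N) (u : Vertex m n → G)
    (ω : Config m n G) :
    F.rowProd o j a l (gauge o u ω) = u (F.pt a j) * F.rowProd o j a l ω * (u (F.pt (a + l) j))⁻¹ := by
  induction l with
  | zero => simp [rowProd]
  | succ l ih =>
    rw [rowProd, ih (by omega), rowProd, upRead_gauge, F.low_he _ _ (by omega) hj,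
      F.high_he _ _ (by omega) hj, add_assoc]
    group

theorem colProd_gauge {i b l : ℕ} (hl : b + l ≤ F.N) (hi : i ≤ F.M) (u : Vertex m n → G)
    (ω : Config m n G) :
    F.colProd o i b l (gauge o u ω) = u (F.pt i b) * F.colProd o i b l ω * (u (F.pt i (b + l)))⁻¹ := by
  induction l with
  | zero => simp [colProd]
  | succ l ih =>
    rw [colProd, ih (by omega), colProd, upRead_gauge, F.low_ve _ _ hi (by omega),
      F.high_ve _ _ hi (by omega), add_assoc]
    group

theorem rowProd_congr {j a l : ℕ} {ω ω' : Config m n G}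
    (h : ∀ k < l, ω (F.he (a + k) j) = ω' (F.he (a + k) j)) :
    F.rowProd o j a l ω = F.rowProd o j a l ω' := by
  induction l with
  | zero => rfl
  | succ l ih =>
    rw [rowProd, rowProd, ih fun k hk => h k (by omega), upRead_inj.mpr (h l (by omega))]

theorem colProd_congr {i b l : ℕ} {ω ω' : Config m n G}
    (h : ∀ k < l, ω (F.ve i (b + k)) = ω' (F.ve i (b + k))) :
    F.colProd o i b l ω = F.colProd o i b l ω' := by
  induction l with
  | zero => rfl
  | succ l ih =>
    rw [colProd, colProd, ih fun k hk => h k (by omega), upRead_inj.mpr (h l (by omega))]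

theorem rowProd_one (j a l : ℕ) : F.rowProd o j a l (1 : Config m n G) = 1 := by
  induction l with
  | zero => rfl
  | succ l ih => rw [rowProd, ih, upRead_one, mul_one]

theorem colProd_one (i b l : ℕ) : F.colProd o i b l (1 : Config m n G) = 1 := by
  induction l with
  | zero => rfl
  | succ l ih => rw [colProd, ih, upRead_one, mul_one]

theorem rowProd_add (j a l l' : ℕ) (ω : Config m n G) :
    F.rowProd o j a (l + l') ω = F.rowProd o j a l ω * F.rowProd o j (a + l) l' ω := by
  induction l' with
  | zero => simp [rowProd]
  | succ l' ih => rw [← add_assoc, rowProd, ih, rowProd, mul_assoc, add_assoc]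

/-! ### Reduction of an operator on a strip to the lower part of the strip -/

section Strip

variable (k₀ k₁ ys : ℕ)

/-- The edges of the strip of columns `k₀` to `k₁`. -/
def strip : Set (Edge m n) := {e | k₀ ≤ F.x (Edge.low e) ∧ F.x (Edge.high e) ≤ k₁}

/-- The edges of the strip which do not lie in rows `≥ ys`. -/
def lowStrip : Set (Edge m n) :=
  {e | k₀ ≤ F.x (Edge.low e) ∧ F.x (Edge.high e) ≤ k₁ ∧ F.y (Edge.low e) < ys}

/-- The vertices of the strip in rows `≥ ys`. -/
def upVertices : Set (Vertex m n) := {v | k₀ ≤ F.x v ∧ F.x v ≤ k₁ ∧ ys ≤ F.y v}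

/-- The vertices of the strip in rows `≥ ys` which do not lie on its two sides. -/
def innerVertices : Set (Vertex m n) := {v | k₀ < F.x v ∧ F.x v < k₁ ∧ ys ≤ F.y v}

/-- The edges in rows `≥ ys - 1` of the strip, with a margin of one column on each side. -/
def upRegion : Set (Edge m n) :=
  {e | k₀ ≤ F.x (Edge.low e) + 1 ∧ F.x (Edge.high e) ≤ k₁ + 1 ∧ ys ≤ F.y (Edge.low e) + 1}

/-- A configuration is flat on a set of edges if it is gauge equivalent to `1` there. -/
def FlatOn (R : Set (Edge m n)) (ω : Config m n G) : Prop :=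
  ∃ φ : Vertex m n → G, ∀ e ∈ R, ω e = gauge o φ 1 e

variable {F o k₀ k₁ ys}

theorem lowStrip_subset_strip : F.lowStrip k₀ k₁ ys ⊆ F.strip k₀ k₁ :=
  fun _ he => ⟨he.1, he.2.1⟩

/-- Two potentials of one flat configuration differ by a right factor, which
`inv_mul_eq_of_gauge_eq` propagates edge by edge. -/
theorem col_const {φ φ' : Vertex m n → G} {i b l : ℕ} (hi : i ≤ F.M) (hl : b + l ≤ F.N)
    (h : ∀ k < l, QuantumDouble.gauge o φ 1 (F.ve i (b + k)) =
      QuantumDouble.gauge o φ' 1 (F.ve i (b + k))) :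
    (φ (F.pt i (b + l)))⁻¹ * φ' (F.pt i (b + l)) = (φ (F.pt i b))⁻¹ * φ' (F.pt i b) := by
  induction l with
  | zero => rfl
  | succ l ih =>
    rw [← ih (by omega) fun k hk => h k (by omega)]
    have := inv_mul_eq_of_gauge_eq (h l (by omega))
    rw [F.low_ve _ _ hi (by omega), F.high_ve _ _ hi (by omega)] at this
    exact this.symm

theorem row_const {φ φ' : Vertex m n → G} {j a l : ℕ} (hj : j ≤ F.N) (hl : a + l ≤ F.M)
    (h : ∀ k < l, QuantumDouble.gauge o φ 1 (F.he (a + k) j) =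
      QuantumDouble.gauge o φ' 1 (F.he (a + k) j)) :
    (φ (F.pt (a + l) j))⁻¹ * φ' (F.pt (a + l) j) = (φ (F.pt a j))⁻¹ * φ' (F.pt a j) := by
  induction l with
  | zero => rfl
  | succ l ih =>
    rw [← ih (by omega) fun k hk => h k (by omega)]
    have := inv_mul_eq_of_gauge_eq (h l (by omega))
    rw [F.low_he _ _ (by omega) hj, F.high_he _ _ (by omega) hj] at this
    exact this.symm

/-- The discrepancy `φ⁻¹ φ'` is constant on the margin column at either side, hence on the side
itself. The two margins are not joined inside the upper region off the strip; equality of the top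
row holonomies identifies their constants with one `δ₀`. Then `φ δ₀ φ'⁻¹` carries `ω'` to `ω` in the
upper strip and is `1` on its sides, so it can be cut off to the inner vertices. -/
theorem exists_gauge_of_eq_off_strip (hk₀ : 1 ≤ k₀) (hk : k₀ < k₁) (hk₁ : k₁ + 1 ≤ F.M)
    (hy : ys ≤ F.N) {ω ω' : Config m n G} (h : FlatOn o (F.upRegion k₀ k₁ ys) ω)
    (h' : FlatOn o (F.upRegion k₀ k₁ ys) ω')
    (hrow : F.rowProd o F.N k₀ (k₁ - k₀) ω = F.rowProd o F.N k₀ (k₁ - k₀) ω')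
    (hoff : ∀ e ∉ F.strip k₀ k₁, ω' e = ω e) :
    ∃ u ∈ gaugeOn G (F.innerVertices k₀ k₁ ys), ∀ e ∉ F.lowStrip k₀ k₁ ys,
      QuantumDouble.gauge o u ω' e = ω e := by
  classical
  obtain ⟨φ, hφ⟩ := h
  obtain ⟨φ', hφ'⟩ := h'
  have key : ∀ e ∈ F.upRegion k₀ k₁ ys, e ∉ F.strip k₀ k₁ →
      QuantumDouble.gauge o φ 1 e = QuantumDouble.gauge o φ' 1 e := fun e he hs => by
    rw [← hφ e he, ← hφ' e he, hoff e hs]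
  let δ : Vertex m n → G := fun v => (φ v)⁻¹ * φ' v
  have hL : ∀ j, ys ≤ j → j ≤ F.N → δ (F.pt k₀ j) = δ (F.pt (k₀ - 1) ys) := by
    intro j hj hjN
    obtain ⟨l, rfl⟩ := Nat.exists_eq_add_of_le hj
    have h1 := col_const (F := F) (o := o) (φ := φ) (φ' := φ') (i := k₀ - 1) (b := ys) (l := l)
      (by omega) hjN fun k hk' => by
        refine key _ ⟨?_, ?_, ?_⟩ fun hs => ?_
        · rw [F.x_low_ve (by omega) (by omega)]; omega
        · rw [F.x_high_ve (by omega) (by omega)]; omega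
        · rw [F.y_low_ve (by omega) (by omega)]; omega
        · have := hs.1
          rw [F.x_low_ve (by omega) (by omega)] at this
          omega
    have h2 := inv_mul_eq_of_gauge_eq (key (F.he (k₀ - 1) (ys + l)) ⟨by
        rw [F.x_low_he (by omega) (by omega)]; omega, by
        rw [F.x_high_he (by omega) (by omega)]; omega, by
        rw [F.y_low_he (by omega) (by omega)]; omega⟩ fun hs => by
          have := hs.1
          rw [F.x_low_he (by omega) (by omega)] at this
          omega)
    rw [F.low_he _ _ (by omega) hjN, F.high_he _ _ (by omega) hjN,
      Nat.sub_add_cancel hk₀] at h2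
    exact h2.symm.trans h1
  have hR : ∀ j, ys ≤ j → j ≤ F.N → δ (F.pt k₁ j) = δ (F.pt (k₁ + 1) ys) := by
    intro j hj hjN
    obtain ⟨l, rfl⟩ := Nat.exists_eq_add_of_le hj
    have h1 := col_const (F := F) (o := o) (φ := φ) (φ' := φ') (i := k₁ + 1) (b := ys) (l := l)
      (by omega) hjN fun k hk' => by
        refine key _ ⟨?_, ?_, ?_⟩ fun hs => ?_
        · rw [F.x_low_ve (by omega) (by omega)]; omega
        · rw [F.x_high_ve (by omega) (by omega)]
        · rw [F.y_low_ve (by omega) (by omega)]; omega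
        · have := hs.2
          rw [F.x_high_ve (by omega) (by omega)] at this
          omega
    have h2 := inv_mul_eq_of_gauge_eq (key (F.he k₁ (ys + l)) ⟨by
        rw [F.x_low_he (by omega) (by omega)]; omega, by
        rw [F.x_high_he (by omega) (by omega)], by
        rw [F.y_low_he (by omega) (by omega)]; omega⟩ fun hs => by
          have := hs.2
          rw [F.x_high_he (by omega) (by omega)] at this
          omega)
    rw [F.low_he _ _ (by omega) hjN, F.high_he _ _ (by omega) hjN] at h2
    exact h2.trans h1
  have hrowφ : ∀ (η : Config m n G) (ψ : Vertex m n → G),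
      (∀ e ∈ F.upRegion k₀ k₁ ys, η e = QuantumDouble.gauge o ψ 1 e) →
      F.rowProd o F.N k₀ (k₁ - k₀) η = ψ (F.pt k₀ F.N) * (ψ (F.pt k₁ F.N))⁻¹ := by
    intro η ψ hη
    rw [F.rowProd_congr o (ω' := QuantumDouble.gauge o ψ 1), F.rowProd_gauge o (by omega) le_rfl,
      rowProd_one, mul_one, Nat.add_sub_cancel' hk.le]
    intro k hk'
    apply hη
    refine ⟨?_, ?_, ?_⟩
    · rw [F.x_low_he (by omega) le_rfl]; omega
    · rw [F.x_high_he (by omega) le_rfl]; omega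
    · rw [F.y_low_he (by omega) le_rfl]; omega
  have hδ : δ (F.pt (k₁ + 1) ys) = δ (F.pt (k₀ - 1) ys) := by
    rw [← hL F.N hy le_rfl, ← hR F.N hy le_rfl]
    rw [hrowφ ω φ hφ, hrowφ ω' φ' hφ'] at hrow
    simp only [δ]
    have h3 : φ (F.pt k₁ F.N) * (φ (F.pt k₀ F.N))⁻¹ = φ' (F.pt k₁ F.N) * (φ' (F.pt k₀ F.N))⁻¹ := by
      simpa using congrArg (·⁻¹) hrow
    rw [inv_mul_eq_iff_eq_mul, ← mul_assoc, h3]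
    group
  set δ₀ := δ (F.pt (k₀ - 1) ys)
  let w : Vertex m n → G := fun v => φ v * δ₀ * (φ' v)⁻¹
  have hw : ∀ v, v ∈ F.upVertices k₀ k₁ ys → v ∉ F.innerVertices k₀ k₁ ys → w v = 1 := by
    intro v hv hv'
    have hδv : δ v = δ₀ := by
      have : F.x v = k₀ ∨ F.x v = k₁ := by
        by_contra hcon
        push Not at hcon
        exact hv' ⟨lt_of_le_of_ne hv.1 hcon.1.symm, lt_of_le_of_ne hv.2.1 hcon.2, hv.2.2⟩
      rcases this with h | h
      · rw [← F.pt_xy v, h]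
        exact hL _ hv.2.2 (F.y_le v)
      · rw [← F.pt_xy v, h]
        exact (hR _ hv.2.2 (F.y_le v)).trans hδ
    simp only [w, ← hδv, δ]
    group
  let u : Vertex m n → G := fun v => if v ∈ F.innerVertices k₀ k₁ ys then w v else 1
  have hu : ∀ v ∈ F.upVertices k₀ k₁ ys, u v = w v := by
    intro v hv
    by_cases h : v ∈ F.innerVertices k₀ k₁ ys
    · simp [u, h]
    · simp [u, h, hw v hv h]
  refine ⟨u, fun v hv => by simp [u, hv], fun e he => ?_⟩
  have hb := F.edge_bounds e
  by_cases hs : e ∈ F.strip k₀ k₁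
  · have hye : ys ≤ F.y (Edge.low e) := by
      by_contra hcon
      exact he ⟨hs.1, hs.2, by omega⟩
    have hmem : e ∈ F.upRegion k₀ k₁ ys := ⟨by have := hs.1; omega, by have := hs.2; omega, by omega⟩
    have h1 := hs.1
    have h2 := hs.2
    rw [hφ e hmem, ← upRead_inj (o := o), upRead_gauge, hu _ ⟨hs.1, by omega, hye⟩,
      hu _ ⟨by omega, hs.2, by omega⟩, upRead_inj.mpr (hφ' e hmem), upRead_gauge, upRead_gauge,
      upRead_one]
    simp only [w]
    group
  · have h3 : ∀ v, v ∈ F.innerVertices k₀ k₁ ys → v ≠ Edge.low e ∧ v ≠ Edge.high e := by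
      intro v hv
      constructor
      · rintro rfl
        exact hs ⟨by have := hv.1; omega, by have := hv.2.1; omega⟩
      · rintro rfl
        exact hs ⟨by have := hv.1; omega, by have := hv.2.1; omega⟩
    rw [gauge_apply_of_eq_one, hoff e hs]
    · simp only [u]
      rw [if_neg fun h => (h3 _ h).1 rfl]
    · simp only [u]
      rw [if_neg fun h => (h3 _ h).2 rfl]

/-- Each row is followed from the left side of the strip, where both transformations are trivial; a
horizontal edge in a row `≥ ys` determines the value at its right end from that at its left end. -/
theorem gauge_unique_off_lowStrip (hk₁ : k₁ ≤ F.M) {ω : Config m n G}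
    {u u' : Vertex m n → G} (hu : u ∈ gaugeOn G (F.innerVertices k₀ k₁ ys))
    (hu' : u' ∈ gaugeOn G (F.innerVertices k₀ k₁ ys))
    (h : ∀ e ∉ F.lowStrip k₀ k₁ ys,
      QuantumDouble.gauge o u ω e = QuantumDouble.gauge o u' ω e) : u = u' := by
  have key : ∀ j, ys ≤ j → j ≤ F.N → ∀ l, k₀ + l < k₁ →
      u (F.pt (k₀ + l) j) = u' (F.pt (k₀ + l) j) := by
    intro j hj hjN l
    induction l with
    | zero =>
      intro hl
      rw [hu _ fun hv => ?_, hu' _ fun hv => ?_] <;>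
      · have := hv.1
        rw [F.x_pt _ _ (by omega) hjN] at this
        omega
    | succ l ih =>
      intro hl
      have h1 := h (F.he (k₀ + l) j) fun he => by
        have := he.2.2
        rw [F.y_low_he (by omega) hjN] at this
        omega
      rw [← upRead_inj (o := o), upRead_gauge, upRead_gauge, F.low_he _ _ (by omega) hjN,
        F.high_he _ _ (by omega) hjN, ih (by omega)] at h1
      simpa [add_assoc] using h1
  funext v
  by_cases hv : v ∈ F.innerVertices k₀ k₁ ys
  · obtain ⟨l, hl⟩ := Nat.exists_eq_add_of_le hv.1.le
    have := key (F.y v) hv.2.2 (F.y_le v) l (by have := hv.2.1; omega)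
    rwa [← hl, F.pt_xy] at this
  · rw [hu v hv, hu' v hv]

/-- Row `ys - 1` and the vertical edges from it to row `ys` lie both in `lowStrip` and in
`upRegion`. Agreement there makes `φ⁻¹ φ'` constant on row `ys`, so `φ' δ₀⁻¹ φ⁻¹` is `1` on that row
and can be extended by `1` below it. -/
theorem exists_gauge_of_eq_on_lowStrip (hk₁ : k₁ + 1 ≤ F.M)
    (hys : 1 ≤ ys) (hy : ys ≤ F.N) {ω ω' : Config m n G}
    (h : FlatOn o (F.upRegion k₀ k₁ ys) ω) (h' : FlatOn o (F.upRegion k₀ k₁ ys) ω')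
    (hlow : ∀ e ∈ F.lowStrip k₀ k₁ ys, ω e = ω' e) :
    ∃ w ∈ gaugeOn G (F.upVertices k₀ k₁ ys),
      (∀ e ∈ F.lowStrip k₀ k₁ ys, ∀ η, QuantumDouble.gauge o w η e = η e) ∧
      ∀ e ∈ F.strip k₀ k₁, QuantumDouble.gauge o w ω e = ω' e := by
  classical
  obtain ⟨φ, hφ⟩ := h
  obtain ⟨φ', hφ'⟩ := h'
  have key : ∀ e ∈ F.upRegion k₀ k₁ ys, e ∈ F.lowStrip k₀ k₁ ys →
      QuantumDouble.gauge o φ 1 e = QuantumDouble.gauge o φ' 1 e := fun e he hs => by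
    rw [← hφ e he, ← hφ' e he, hlow e hs]
  let δ : Vertex m n → G := fun v => (φ v)⁻¹ * φ' v
  set δ₀ := δ (F.pt k₀ (ys - 1)) with hδ₀
  have hrow : ∀ i, k₀ ≤ i → i ≤ k₁ → δ (F.pt i ys) = δ₀ := by
    intro i hi hi'
    obtain ⟨l, rfl⟩ := Nat.exists_eq_add_of_le hi
    have h1 := row_const (F := F) (o := o) (φ := φ) (φ' := φ') (j := ys - 1) (a := k₀) (l := l)
      (by omega) (by omega) fun k hk' => by
        refine key _ ⟨?_, ?_, ?_⟩ ⟨?_, ?_, ?_⟩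
        · rw [F.x_low_he (by omega) (by omega)]; omega
        · rw [F.x_high_he (by omega) (by omega)]; omega
        · rw [F.y_low_he (by omega) (by omega)]; omega
        · rw [F.x_low_he (by omega) (by omega)]; omega
        · rw [F.x_high_he (by omega) (by omega)]; omega
        · rw [F.y_low_he (by omega) (by omega)]; omega
    have h2 := inv_mul_eq_of_gauge_eq (key (F.ve (k₀ + l) (ys - 1)) ⟨by
        rw [F.x_low_ve (by omega) (by omega)]; omega, by
        rw [F.x_high_ve (by omega) (by omega)]; omega, by
        rw [F.y_low_ve (by omega) (by omega)]; omega⟩ ⟨by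
        rw [F.x_low_ve (by omega) (by omega)]; omega, by
        rw [F.x_high_ve (by omega) (by omega)]; omega, by
        rw [F.y_low_ve (by omega) (by omega)]; omega⟩)
    rw [F.low_ve _ _ (by omega) (by omega), F.high_ve _ _ (by omega) (by omega),
      Nat.sub_add_cancel hys] at h2
    exact h2.symm.trans h1
  let w : Vertex m n → G := fun v =>
    if v ∈ F.upVertices k₀ k₁ ys then φ' v * δ₀⁻¹ * (φ v)⁻¹ else 1
  have hw : ∀ v, F.y v ≤ ys → w v = 1 := by
    intro v hv
    by_cases h : v ∈ F.upVertices k₀ k₁ ys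
    · have hv' : δ v = δ₀ := by
        rw [← F.pt_xy v, le_antisymm hv h.2.2]
        exact hrow _ h.1 h.2.1
      simp only [w, h, if_true, ← hv', δ]
      group
    · simp [w, h]
  have htriv : ∀ e ∈ F.lowStrip k₀ k₁ ys, ∀ η, QuantumDouble.gauge o w η e = η e := by
    intro e he η
    have hb := F.edge_bounds e
    have := he.2.2
    exact gauge_apply_of_eq_one (hw _ (by omega)) (hw _ (by omega)) η
  refine ⟨w, fun v hv => by simp [w, hv], htriv, fun e he => ?_⟩
  have hb := F.edge_bounds e
  by_cases hl : F.y (Edge.low e) < ys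
  · rw [htriv e ⟨he.1, he.2, hl⟩, hlow e ⟨he.1, he.2, hl⟩]
  · have h1 := he.1
    have h2 := he.2
    have hmem : e ∈ F.upRegion k₀ k₁ ys := ⟨by omega, by omega, by omega⟩
    have m1 : Edge.low e ∈ F.upVertices k₀ k₁ ys := ⟨h1, by omega, by omega⟩
    have m2 : Edge.high e ∈ F.upVertices k₀ k₁ ys := ⟨by omega, h2, by omega⟩
    rw [hφ' e hmem, ← upRead_inj (o := o), upRead_gauge, upRead_inj.mpr (hφ e hmem), upRead_gauge,
      upRead_gauge, upRead_one]
    simp only [w, m1, m2, if_true]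
    group

end Strip

end Frame

/-! ### Averaging matrix elements over gauge transformations -/

namespace Frame

variable {m n : ℕ} {G : Type*} [Group G] [Fintype G] {F : Frame m n} {o : Orientation m n}
  {k₀ k₁ ys : ℕ}

open scoped Classical in
/-- The matrix elements of `X`, summed over the gauge transformations of the inner vertices in one
argument, and over simultaneous gauge transformations of the upper vertices in both arguments. -/
def gaugeSum (F : Frame m n) (o : Orientation m n) (k₀ k₁ ys : ℕ) (X : Op m n G)
    (ω' ω : Config m n G) : ℂ :=
  ∑ w : gaugeOn G (F.upVertices k₀ k₁ ys), ∑ u : gaugeOn G (F.innerVertices k₀ k₁ ys),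
    X (gauge o (u : Vertex m n → G)⁻¹ (gauge o (w : Vertex m n → G) ω'))
      (gauge o (w : Vertex m n → G) ω)

/-- The average over `w` makes the sum blind to the upper strip: two flat configurations that agree
on the lower strip differ on the strip by an upper gauge transformation, which is absorbed by a
shift of `w`. -/
theorem gaugeSum_congr (hk₁ : k₁ + 1 ≤ F.M)
    (hys : 1 ≤ ys) (hy : ys ≤ F.N) {X : Op m n G} (hX : SuppOn X (F.strip k₀ k₁))
    {ω' ω η' η : Config m n G} (hω : FlatOn o (F.upRegion k₀ k₁ ys) ω)
    (hη : FlatOn o (F.upRegion k₀ k₁ ys) η)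
    (h₁ : ∀ e ∉ F.lowStrip k₀ k₁ ys, ω' e = ω e) (h₂ : ∀ e ∉ F.lowStrip k₀ k₁ ys, η' e = η e)
    (h₃ : ∀ e ∈ F.lowStrip k₀ k₁ ys, ω' e = η' e) (h₄ : ∀ e ∈ F.lowStrip k₀ k₁ ys, ω e = η e) :
    F.gaugeSum o k₀ k₁ ys X ω' ω = F.gaugeSum o k₀ k₁ ys X η' η := by
  classical
  obtain ⟨w₀, hw₀, hlow, hstrip⟩ := exists_gauge_of_eq_on_lowStrip hk₁ hys hy hω hη h₄
  have hstrip' : ∀ e ∈ F.strip k₀ k₁, gauge o w₀ ω' e = η' e := by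
    intro e he
    by_cases hl : e ∈ F.lowStrip k₀ k₁ ys
    · rw [hlow e hl, h₃ e hl]
    · rw [h₂ e hl, ← hstrip e he, gauge_apply_congr, h₁ e hl]
  have hinner : ∀ u ∈ gaugeOn G (F.innerVertices k₀ k₁ ys), ∀ e ∉ F.strip k₀ k₁,
      ∀ ξ : Config m n G, gauge o u ξ e = ξ e := by
    intro u hu e he ξ
    have hb := F.edge_bounds e
    refine gauge_apply_of_eq_one (hu _ fun h => he ⟨?_, ?_⟩) (hu _ fun h => he ⟨?_, ?_⟩) ξ <;>
    · have h1 := h.1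
      have h2 := h.2.1
      omega
  rw [gaugeSum, gaugeSum]
  rw [← Equiv.sum_comp (Equiv.mulRight
    (⟨w₀, hw₀⟩ : gaugeOn G (F.upVertices k₀ k₁ ys)))]
  refine Finset.sum_congr rfl fun w _ => Finset.sum_congr rfl fun u _ => ?_
  have hu := inv_mem u.2
  simp only [Equiv.coe_mulRight, Subgroup.coe_mul, gauge_mul]
  apply hX.congr
  · intro e he
    rw [hinner _ hu e he, gauge_apply_congr, gauge_apply_congr]
    exact h₁ e fun h => he (lowStrip_subset_strip h)
  · intro e he
    rw [hinner _ hu e he, gauge_apply_congr]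
    exact h₂ e fun h => he (lowStrip_subset_strip h)
  · intro e he
    rw [gauge_apply_congr, gauge_apply_congr]
    exact hstrip' e he
  · intro e he
    rw [gauge_apply_congr]
    exact hstrip e he

/-- A nonzero contribution to the expectation pairs two configurations in the support of `χ` that
agree off the strip. Exactly one inner gauge transformation of the left one makes them agree off the
lower strip as well. Inserting the sum over these transformations and reindexing, with `χ`
invariant, leaves only pairs that agree off the lower strip. The further average over simultaneous
upper transformations accounts for the cardinality on the left. -/
theorem dotProduct_eq_gaugeSum (hk₀ : 1 ≤ k₀) (hk : k₀ < k₁) (hk₁ : k₁ + 1 ≤ F.M)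
    (hy : ys ≤ F.N) {X : Op m n G} (hX : SuppOn X (F.strip k₀ k₁)) {χ : State m n G}
    (hflat : ∀ ω, χ ω ≠ 0 → FlatOn o (F.upRegion k₀ k₁ ys) ω)
    (hrow : ∀ ω ω', χ ω ≠ 0 → χ ω' ≠ 0 → (∀ e ∉ F.strip k₀ k₁, ω' e = ω e) →
      F.rowProd o F.N k₀ (k₁ - k₀) ω = F.rowProd o F.N k₀ (k₁ - k₀) ω')
    (hinv : ∀ u ∈ gaugeOn G (F.upVertices k₀ k₁ ys), ∀ ω, χ (gauge o u ω) = χ ω)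
    [DecidablePred fun p : Config m n G × Config m n G =>
      ∀ e ∉ F.lowStrip k₀ k₁ ys, p.1 e = p.2 e] :
    (Nat.card (gaugeOn G (F.upVertices k₀ k₁ ys)) : ℂ) * (star χ ⬝ᵥ X *ᵥ χ) =
      ∑ p : Config m n G × Config m n G, if ∀ e ∉ F.lowStrip k₀ k₁ ys, p.1 e = p.2 e then
        star (χ p.1) * F.gaugeSum o k₀ k₁ ys X p.1 p.2 * χ p.2 else 0 := by
  classical
  have hsub : F.innerVertices k₀ k₁ ys ⊆ F.upVertices k₀ k₁ ys :=
    fun v hv => ⟨hv.1.le, hv.2.1.le, hv.2.2⟩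
  have hinv' : ∀ u ∈ gaugeOn G (F.innerVertices k₀ k₁ ys), ∀ ω, χ (gauge o u ω) = χ ω :=
    fun u hu => hinv u fun v hv => hu v fun h => hv (hsub h)
  let T : Config m n G → Config m n G → ℂ := fun ω' ω => star (χ ω') * X ω' ω * χ ω
  let Ag : Config m n G → Config m n G → Prop :=
    fun ω' ω => ∀ e ∉ F.lowStrip k₀ k₁ ys, ω' e = ω e
  have step0 : star χ ⬝ᵥ X *ᵥ χ = ∑ ω, ∑ ω', T ω' ω := by
    rw [Finset.sum_comm]
    simp only [dotProduct, Matrix.mulVec, Finset.mul_sum, T, Pi.star_apply, mul_assoc]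
  have step1 : ∀ ω' ω, T ω' ω = ∑ u : gaugeOn G (F.innerVertices k₀ k₁ ys),
      if Ag (gauge o (u : Vertex m n → G) ω') ω then T ω' ω else 0 := by
    intro ω' ω
    by_cases hT : T ω' ω = 0
    · simp [hT]
    have hχ' : χ ω' ≠ 0 := fun h => hT (by simp [T, h])
    have hχ : χ ω ≠ 0 := fun h => hT (by simp [T, h])
    have hoff : ∀ e ∉ F.strip k₀ k₁, ω' e = ω e := by
      by_contra hcon
      push Not at hcon
      obtain ⟨e, he, hne⟩ := hcon
      exact hT (by simp [T, hX.1 ω' ω ⟨e, he, hne⟩])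
    obtain ⟨u, hu, hag⟩ := exists_gauge_of_eq_off_strip hk₀ hk hk₁ hy (hflat ω hχ) (hflat ω' hχ')
      (hrow ω ω' hχ hχ' hoff) hoff
    rw [Finset.sum_eq_single (⟨u, hu⟩ : gaugeOn G (F.innerVertices k₀ k₁ ys))]
    · rw [if_pos hag]
    · intro u' _ hne
      rw [if_neg]
      intro hag'
      refine hne (Subtype.ext ?_)
      exact gauge_unique_off_lowStrip (by omega) u'.2 hu fun e he => by rw [hag' e he, hag e he]
    · simp
  let Z : Config m n G → Config m n G → ℂ := fun ω' ω =>
    ∑ u : gaugeOn G (F.innerVertices k₀ k₁ ys), X (gauge o (u : Vertex m n → G)⁻¹ ω') ω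
  have step2 : star χ ⬝ᵥ X *ᵥ χ =
      ∑ ω, ∑ ω', if Ag ω' ω then star (χ ω') * Z ω' ω * χ ω else 0 := by
    rw [step0]
    refine Finset.sum_congr rfl fun ω _ => ?_
    calc ∑ ω', T ω' ω = ∑ u : gaugeOn G (F.innerVertices k₀ k₁ ys), ∑ ω',
          if Ag (gauge o (u : Vertex m n → G) ω') ω then T ω' ω else 0 := by
          rw [Finset.sum_comm]
          exact Finset.sum_congr rfl fun ω' _ => step1 ω' ω
      _ = ∑ u : gaugeOn G (F.innerVertices k₀ k₁ ys), ∑ ω', if Ag ω' ω then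
          star (χ ω') * X (gauge o (u : Vertex m n → G)⁻¹ ω') ω * χ ω else 0 := by
          refine Finset.sum_congr rfl fun u _ => ?_
          rw [← Equiv.sum_comp (gaugeEquiv o (u : Vertex m n → G)) fun ω' => if Ag ω' ω then
            star (χ ω') * X (gauge o (u : Vertex m n → G)⁻¹ ω') ω * χ ω else 0]
          refine Finset.sum_congr rfl fun ω' _ => ?_
          have h2 : gauge o (u : Vertex m n → G)⁻¹ (gaugeEquiv o (u : Vertex m n → G) ω') = ω' :=
            (gaugeEquiv o (u : Vertex m n → G)).symm_apply_apply ω'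
          rw [h2]
          change _ = if Ag (gauge o (u : Vertex m n → G) ω') ω then
            star (χ (gauge o (u : Vertex m n → G) ω')) * X ω' ω * χ ω else 0
          rw [hinv' u u.2]
      _ = _ := by
          rw [Finset.sum_comm]
          refine Finset.sum_congr rfl fun ω' _ => ?_
          by_cases h : Ag ω' ω
          · simp only [h, if_true, Z, Finset.mul_sum, Finset.sum_mul]
          · simp [h]
  have step3 : ∀ w : gaugeOn G (F.upVertices k₀ k₁ ys), star χ ⬝ᵥ X *ᵥ χ =
      ∑ ω, ∑ ω', if Ag ω' ω then star (χ ω') * Z (gauge o (w : Vertex m n → G) ω')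
        (gauge o (w : Vertex m n → G) ω) * χ ω else 0 := by
    intro w
    rw [step2, ← Equiv.sum_comp (gaugeEquiv o (w : Vertex m n → G))]
    refine Finset.sum_congr rfl fun ω _ => ?_
    rw [← Equiv.sum_comp (gaugeEquiv o (w : Vertex m n → G))]
    refine Finset.sum_congr rfl fun ω' _ => ?_
    change (if Ag (gauge o (w : Vertex m n → G) ω') (gauge o (w : Vertex m n → G) ω) then
      star (χ (gauge o (w : Vertex m n → G) ω')) * Z (gauge o (w : Vertex m n → G) ω')
        (gauge o (w : Vertex m n → G) ω) * χ (gauge o (w : Vertex m n → G) ω) else 0) = _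
    rw [hinv w w.2, hinv w w.2]
    have : Ag (gauge o (w : Vertex m n → G) ω') (gauge o (w : Vertex m n → G) ω) ↔ Ag ω' ω := by
      simp only [Ag, gauge_apply_congr]
    simp only [this]
  rw [Nat.card_eq_fintype_card, ← nsmul_eq_mul, ← Finset.card_univ, ← Finset.sum_const,
    Finset.sum_congr rfl fun w _ => step3 w, Fintype.sum_prod_type_right, Finset.sum_comm]
  refine Finset.sum_congr rfl fun ω _ => ?_
  rw [Finset.sum_comm]
  refine Finset.sum_congr rfl fun ω' _ => ?_
  by_cases h : Ag ω' ω
  · have h' : ∀ e ∉ F.lowStrip k₀ k₁ ys, ω' e = ω e := h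
    simp only [h, if_true, gaugeSum, ← Finset.mul_sum, ← Finset.sum_mul, Z]
    rw [if_pos h']
  · have h' : ¬∀ e ∉ F.lowStrip k₀ k₁ ys, ω' e = ω e := h
    simp only [h, if_false, Finset.sum_const_zero, if_neg h']

/-- On states which are flat and gauge invariant in the upper part of a strip, and in which the
upper part of the strip determines its holonomy, the expectation of an operator on the strip agrees
with that of an operator on the lower part of the strip. -/
theorem exists_suppOn_lowStrip (o : Orientation m n) (hk₀ : 1 ≤ k₀) (hk : k₀ < k₁)
    (hk₁ : k₁ + 1 ≤ F.M) (hys : 1 ≤ ys) (hy : ys ≤ F.N) {X : Op m n G}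
    (hX : SuppOn X (F.strip k₀ k₁)) :
    ∃ Y : Op m n G, SuppOn Y (F.lowStrip k₀ k₁ ys) ∧ ∀ χ : State m n G,
      (∀ ω, χ ω ≠ 0 → FlatOn o (F.upRegion k₀ k₁ ys) ω) →
      (∀ ω ω', χ ω ≠ 0 → χ ω' ≠ 0 → (∀ e ∉ F.strip k₀ k₁, ω' e = ω e) →
        F.rowProd o F.N k₀ (k₁ - k₀) ω = F.rowProd o F.N k₀ (k₁ - k₀) ω') →
      (∀ u ∈ gaugeOn G (F.upVertices k₀ k₁ ys), ∀ ω, χ (gauge o u ω) = χ ω) →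
      star χ ⬝ᵥ X *ᵥ χ = star χ ⬝ᵥ Y *ᵥ χ := by
  classical
  let L := F.lowStrip k₀ k₁ ys
  let Good : (L → G) → (L → G) → Config m n G × Config m n G → Prop := fun a' a p =>
    (∀ e ∉ L, p.1 e = p.2 e) ∧ FlatOn o (F.upRegion k₀ k₁ ys) p.2 ∧
      (∀ e : L, p.1 e = a' e) ∧ ∀ e : L, p.2 e = a e
  -- The kernel of `Y` on the lower strip is computed from an arbitrary extension that is flat
  -- above; by `gaugeSum_congr` the choice is immaterial. The value `0` is harmless, since the
  -- states considered have no amplitude where no extension exists.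
  let κ : (L → G) → (L → G) → ℂ := fun a' a => if h : ∃ p, Good a' a p then
    F.gaugeSum o k₀ k₁ ys X h.choose.1 h.choose.2 else 0
  let C : ℂ := Nat.card (gaugeOn G (F.upVertices k₀ k₁ ys))
  have hC : C ≠ 0 := Nat.cast_ne_zero.mpr Nat.card_pos.ne'
  let Y : Op m n G := Matrix.of fun ω' ω =>
    if ∀ e ∉ L, ω' e = ω e then C⁻¹ * κ (fun e => ω' e) (fun e => ω e) else 0
  refine ⟨Y, ⟨fun ω' ω ⟨e, he, hne⟩ => ?_, fun c hc ω' ω => ?_⟩, fun χ hflat hrow hinv => ?_⟩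
  · simp only [Y, Matrix.of_apply]
    rw [if_neg fun h => hne (h e he)]
  · have h : ∀ η : Config m n G, (fun e : L => (c * η) e) = fun e : L => η e := fun η => by
      funext e
      simp [hc e e.2]
    simp only [Y, Matrix.of_apply, h]
    simp only [Pi.mul_apply, mul_right_inj]
  · have h := dotProduct_eq_gaugeSum hk₀ hk hk₁ hy hX hflat hrow hinv
    rw [← mul_right_inj' (a := (Nat.card (gaugeOn G (F.upVertices k₀ k₁ ys)) : ℂ)) hC, h]
    rw [Fintype.sum_prod_type]
    simp only [dotProduct, Matrix.mulVec, Finset.mul_sum]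
    refine Finset.sum_congr rfl fun ω' _ => Finset.sum_congr rfl fun ω _ => ?_
    simp only [Y, Matrix.of_apply, Pi.star_apply]
    change (if ∀ e ∉ L, ω' e = ω e then _ else _) = C * _
    by_cases hag : ∀ e ∉ L, ω' e = ω e
    · rw [if_pos hag, if_pos hag]
      by_cases hχ : χ ω = 0
      · simp [hχ]
      have hex : ∃ p, Good (fun e => ω' e) (fun e => ω e) p :=
        ⟨(ω', ω), hag, hflat ω hχ, fun _ => rfl, fun _ => rfl⟩
      have hκ : κ (fun e => ω' e) (fun e => ω e) = F.gaugeSum o k₀ k₁ ys X ω' ω := by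
        simp only [κ]
        rw [dif_pos hex]
        obtain ⟨g1, g2, g3, g4⟩ := hex.choose_spec
        exact gaugeSum_congr hk₁ hys hy hX g2 (hflat ω hχ) g1 hag
          (fun e he => g3 ⟨e, he⟩) (fun e he => g4 ⟨e, he⟩)
      rw [hκ]
      field_simp
    · rw [if_neg hag, if_neg hag]
      simp

end Frame

/-! ### Projections, permutation operators and a Bessel inequality -/

section Operators

variable {m n : ℕ} {G : Type*} [Fintype G] [DecidableEq G]

theorem basisProj_mulVec (P : Config m n G → Prop) [DecidablePred P] (v : State m n G) :
    basisProj P *ᵥ v = fun ω => if P ω then v ω else 0 := by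
  funext ω
  rw [basisProj, Matrix.mulVec_diagonal]
  split_ifs <;> simp

theorem basisProj_mulVec_eq_self_iff {P : Config m n G → Prop} [DecidablePred P]
    {v : State m n G} : basisProj P *ᵥ v = v ↔ ∀ ω, v ω ≠ 0 → P ω := by
  rw [basisProj_mulVec, funext_iff]
  refine forall_congr' fun ω => ?_
  by_cases h : P ω <;> simp [h, eq_comm]

theorem basisProj_mul_self (P : Config m n G → Prop) [DecidablePred P] :
    basisProj P * basisProj P = basisProj P := by
  rw [basisProj, Matrix.diagonal_mul_diagonal]
  simp

omit [Fintype G] in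
theorem conjTranspose_basisProj (P : Config m n G → Prop) [DecidablePred P] :
    (basisProj P)ᴴ = basisProj P := by
  rw [basisProj, Matrix.diagonal_conjTranspose]
  congr 1
  funext ω
  by_cases h : P ω <;> simp [h]

theorem sum_basisProj_eq (W : Config m n G → G) : ∑ g, basisProj (fun ω => W ω = g) = 1 := by
  ext ω' ω
  rw [Matrix.sum_apply]
  by_cases h : ω' = ω
  · subst h
    simp [basisProj]
  · simp [basisProj, h]

theorem basisMap_mulVec (f : Config m n G ≃ Config m n G) (v : State m n G) :
    basisMap f *ᵥ v = fun ω => v (f.symm ω) := by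
  funext ω
  rw [Matrix.mulVec, dotProduct, Finset.sum_eq_single (f.symm ω)]
  · simp [basisMap]
  · intro η _ hη
    rw [basisMap, Matrix.of_apply, if_neg, zero_mul]
    rintro rfl
    simp at hη
  · simp

omit [Fintype G] in
theorem conjTranspose_basisMap (f : Config m n G ≃ Config m n G) :
    (basisMap f)ᴴ = basisMap f.symm := by
  ext ω' ω
  simp only [basisMap, Matrix.conjTranspose_apply, Matrix.of_apply]
  have : ω = f ω' ↔ ω' = f.symm ω := by rw [Equiv.eq_symm_apply, eq_comm]
  by_cases h : ω = f ω'
  · rw [if_pos h, if_pos (this.mp h), star_one]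
  · rw [if_neg h, if_neg (mt this.mpr h), star_zero]

theorem basisMap_mul_basisMap (f g : Config m n G → Config m n G) :
    basisMap f * basisMap g = basisMap (f ∘ g) := by
  ext ω' ω
  rw [Matrix.mul_apply, Finset.sum_eq_single (g ω)]
  · simp [basisMap]
  · intro η _ hη
    simp [basisMap, hη]
  · simp

omit [Fintype G] in
theorem basisMap_id : basisMap (id : Config m n G → Config m n G) = 1 := by
  ext ω' ω
  simp [basisMap, Matrix.one_apply]

theorem basisProj_mul_basisMap_mul_basisProj {P : Config m n G → Prop} [DecidablePred P]
    {f : Config m n G → Config m n G} (h : ∀ ω, P ω → ¬P (f ω)) :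
    basisProj P * basisMap f * basisProj P = 0 := by
  ext ω' ω
  rw [basisProj, Matrix.mul_diagonal, Matrix.diagonal_mul, Matrix.zero_apply, basisMap,
    Matrix.of_apply]
  by_cases h₁ : P ω
  · by_cases h₂ : ω' = f ω
    · simp [h₂, h ω h₁]
    · simp [h₂]
  · simp [h₁]

theorem star_star_dotProduct {ι : Type*} [Fintype ι] (v w : ι → ℂ) :
    star (star v ⬝ᵥ w) = star w ⬝ᵥ v := by
  simp [dotProduct, mul_comm]

theorem star_dotProduct_self {ι : Type*} [Fintype ι] (v : ι → ℂ) :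
    star v ⬝ᵥ v = ((∑ i, ‖v i‖ ^ 2 : ℝ) : ℂ) := by
  simp [dotProduct, Complex.conj_mul']

omit [DecidableEq G] in
/-- If the vectors `X h χ` for `h` in a finite group are orthogonal, and `χ` is the component of the
invariant vector `Φ` in its direction, then `χ` is short. -/
theorem card_mul_norm_le_of_orthogonal [Group G] {ι : Type*} [Fintype ι] [DecidableEq ι]
    {X : G → Matrix ι ι ℂ} (hX₁ : X 1 = 1) (hX : ∀ h k, (X h)ᴴ * X k = X (h⁻¹ * k))
    {Φ χ : ι → ℂ} (hΦ : ∀ h, X h *ᵥ Φ = Φ) (hχ : ∀ h, h ≠ 1 → star χ ⬝ᵥ X h *ᵥ χ = 0)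
    (hΦχ : star Φ ⬝ᵥ χ = star χ ⬝ᵥ χ) :
    (Fintype.card G : ℝ) * (star χ ⬝ᵥ χ).re ≤ (star Φ ⬝ᵥ Φ).re := by
  have hXX : ∀ h k (v w : ι → ℂ), star (X h *ᵥ v) ⬝ᵥ X k *ᵥ w = star v ⬝ᵥ X (h⁻¹ * k) *ᵥ w := by
    intro h k v w
    rw [Matrix.star_mulVec, ← Matrix.dotProduct_mulVec, Matrix.mulVec_mulVec, hX]
  set s : ι → ℂ := ∑ h, X h *ᵥ χ with hs
  have h1 : star Φ ⬝ᵥ s = Fintype.card G * (star χ ⬝ᵥ χ) := by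
    rw [hs, dotProduct_sum, Finset.sum_congr rfl fun h _ => (?_ : _ = star χ ⬝ᵥ χ)]
    · simp
    · have := hXX h h Φ χ
      rwa [inv_mul_cancel, hX₁, Matrix.one_mulVec, hΦ, hΦχ] at this
  have h2 : star s ⬝ᵥ s = Fintype.card G * (star χ ⬝ᵥ χ) := by
    rw [hs, star_sum, sum_dotProduct, Finset.sum_congr rfl fun h _ => (?_ : _ = star χ ⬝ᵥ χ)]
    · simp
    · rw [dotProduct_sum, Finset.sum_eq_single h]
      · rw [hXX, inv_mul_cancel, hX₁, Matrix.one_mulVec]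
      · intro k _ hk
        rw [hXX]
        refine hχ _ fun h' => hk ?_
        rw [inv_mul_eq_one] at h'
        exact h'.symm
      · simp
  have h3 : star s ⬝ᵥ Φ = Fintype.card G * (star χ ⬝ᵥ χ) := by
    rw [← star_star_dotProduct, h1, star_mul', star_star_dotProduct]
    simp
  -- The products `⟨Φ, s⟩`, `⟨s, Φ⟩` and `⟨s, s⟩` all equal `|G| ‖χ‖²`, so `‖Φ - s‖² ≥ 0` is the
  -- claim.
  have h6 : 0 ≤ (star (Φ - s) ⬝ᵥ (Φ - s)).re := by
    rw [star_dotProduct_self, Complex.ofReal_re]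
    positivity
  rw [star_sub, sub_dotProduct, dotProduct_sub, dotProduct_sub, h1, h2, h3] at h6
  simp only [Complex.sub_re, sub_self, sub_zero, Complex.mul_re, Complex.natCast_re,
    Complex.natCast_im, zero_mul] at h6
  linarith

end Operators

namespace Frame

variable {m n : ℕ} {G : Type*} [Group G] (F : Frame m n) (o : Orientation m n)

/-! ### Closed dual strings along a column -/

/-- The action of the closed dual string which crosses the edges between the columns `c` and
`c + 1`. -/
def dualString (c : ℕ) (k : G) (ω : Config m n G) : Config m n G := fun e =>
  if F.x (Edge.low e) = c ∧ F.x (Edge.high e) = c + 1 then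
    if o e then (F.colProd o c 0 (F.y (Edge.low e)) ω)⁻¹ * k *
      F.colProd o c 0 (F.y (Edge.low e)) ω * ω e
    else ω e * ((F.colProd o c 0 (F.y (Edge.low e)) ω)⁻¹ * k *
      F.colProd o c 0 (F.y (Edge.low e)) ω)⁻¹
  else ω e

variable {F o} {c : ℕ}

theorem upRead_dualString (k : G) (ω : Config m n G) (e : Edge m n) :
    upRead o e (F.dualString o c k ω) =
      if F.x (Edge.low e) = c ∧ F.x (Edge.high e) = c + 1 then
        (F.colProd o c 0 (F.y (Edge.low e)) ω)⁻¹ * k * F.colProd o c 0 (F.y (Edge.low e)) ω *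
          upRead o e ω
      else upRead o e ω := by
  by_cases h : F.x (Edge.low e) = c ∧ F.x (Edge.high e) = c + 1
  · by_cases h' : o e = true <;> simp [upRead, dualString, h, h', mul_assoc]
  · simp [upRead, dualString, h]

theorem dualString_of_ne (k : G) (ω : Config m n G) {e : Edge m n}
    (h : ¬(F.x (Edge.low e) = c ∧ F.x (Edge.high e) = c + 1)) :
    F.dualString o c k ω e = ω e := by
  rw [dualString, if_neg h]

theorem colProd_dualString (hc : c < F.M) {j : ℕ} (hj : j ≤ F.N) (k : G) (ω : Config m n G) :
    F.colProd o c 0 j (F.dualString o c k ω) = F.colProd o c 0 j ω := by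
  refine F.colProd_congr o fun i hi => dualString_of_ne k ω ?_
  rw [F.x_high_ve hc.le (by omega)]
  omega

theorem dualString_mul (hc : c < F.M) (k l : G) (ω : Config m n G) :
    F.dualString o c (k * l) ω = F.dualString o c k (F.dualString o c l ω) := by
  funext e
  rw [← upRead_inj (o := o), upRead_dualString, upRead_dualString, upRead_dualString,
    colProd_dualString hc (F.y_le _)]
  split_ifs
  · group
  · rfl

theorem dualString_one (ω : Config m n G) : F.dualString o c 1 ω = ω := by
  funext e
  rw [← upRead_inj (o := o), upRead_dualString]
  simp

/-- The action of a closed dual string as a permutation of the configurations. -/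
def dualStringEquiv (hc : c < F.M) (o : Orientation m n) (k : G) :
    Config m n G ≃ Config m n G where
  toFun := F.dualString o c k
  invFun := F.dualString o c k⁻¹
  left_inv ω := by rw [← dualString_mul hc, inv_mul_cancel, dualString_one]
  right_inv ω := by rw [← dualString_mul hc, mul_inv_cancel, dualString_one]

/-- Transport along column `c` turns the left factors of the string into one right factor `s` of the
potential. Multiplying `φ` by `s` on all columns up to `c` is visible only on the crossed edges. -/
theorem dualString_gauge_one (hc : c < F.M) (k : G) (φ : Vertex m n → G) :
    ∃ φ', F.dualString o c k (gauge o φ 1) = gauge o φ' 1 := by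
  classical
  let s := (φ (F.pt c 0))⁻¹ * k * φ (F.pt c 0)
  refine ⟨fun v => φ v * if F.x v ≤ c then s else 1, ?_⟩
  funext e
  have hb := F.edge_bounds e
  rw [← upRead_inj (o := o), upRead_dualString, upRead_gauge, upRead_gauge, upRead_one]
  by_cases h : F.x (Edge.low e) = c ∧ F.x (Edge.high e) = c + 1
  · have hlow : F.pt c (F.y (Edge.low e)) = Edge.low e := by rw [← h.1, F.pt_xy]
    rw [if_pos h, F.colProd_gauge o (by have := F.y_le (Edge.low e); omega) hc.le, colProd_one,
      zero_add, hlow, if_pos (by omega), if_neg (by omega)]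
    simp only [s]
    group
  · rw [if_neg h]
    by_cases h' : F.x (Edge.low e) ≤ c
    · rw [if_pos h', if_pos (by omega)]
      group
    · rw [if_neg h', if_neg (by omega)]
      group

/-- Row `0` is crossed exactly once, and the transport along the column is empty there, so the
string inserts the bare factor `k` into the product. -/
theorem rowProd_dualString_ne {a b : ℕ} (hac : a ≤ c) (hcb : c < b) (hb : b ≤ F.M) {k : G}
    (hk : k ≠ 1) (ω : Config m n G) :
    F.rowProd o 0 a (b - a) (F.dualString o c k ω) ≠ F.rowProd o 0 a (b - a) ω := by
  have hsplit : b - a = (c - a) + (1 + (b - (c + 1))) := by omega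
  have h1 : F.rowProd o 0 a (c - a) (F.dualString o c k ω) = F.rowProd o 0 a (c - a) ω :=
    F.rowProd_congr o fun i hi => dualString_of_ne k ω (by
      rw [F.x_low_he (by omega) (by omega)]; omega)
  have h2 : F.rowProd o 0 (c + 1) (b - (c + 1)) (F.dualString o c k ω) =
      F.rowProd o 0 (c + 1) (b - (c + 1)) ω :=
    F.rowProd_congr o fun i hi => dualString_of_ne k ω (by
      rw [F.x_low_he (by omega) (by omega)]; omega)
  have h3 : a + (c - a) = c := by omega
  rw [hsplit, rowProd_add, rowProd_add, rowProd_add, rowProd_add, h3, h1, h2]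
  intro h
  apply hk
  simp only [mul_right_inj, mul_left_inj, rowProd, one_mul, add_zero, upRead_dualString] at h
  rw [if_pos ⟨F.x_low_he (by omega) (by omega), F.x_high_he (by omega) (by omega)⟩,
    F.y_low_he (by omega) (by omega)] at h
  simpa [colProd] using h

/-- The set contains the crossed edges and also the vertical edges of column `c`, from which the
transport is read. -/
theorem suppOn_dualString [Fintype G] [DecidableEq G] (hc : c < F.M) (k : G) :
    SuppOn (basisMap (F.dualString o c k)) {e | F.x (Edge.low e) = c} := by
  refine suppOn_basisMap (fun ω e he => dualString_of_ne k ω fun h => he h.1)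
    fun ω ω' h e he => ?_
  rw [← upRead_inj (o := o), upRead_dualString, upRead_dualString, upRead_inj.mpr (h e he),
    F.colProd_congr o (ω' := ω')]
  intro i hi
  have := F.y_le (Edge.low e)
  exact h _ (F.x_low_ve hc.le (by omega))

end Frame

/-! ### Flat states whose amplitudes depend on a holonomy -/

section FlatStates

variable {m n : ℕ} {G : Type*} [Group G]

/-- `Φ` is the superposition of flat configurations in which `gauge o φ 1` has the amplitude
`f (φ v₀ * (φ v₁)⁻¹)`. -/
def IsFlatState (o : Orientation m n) (v₀ v₁ : Vertex m n) (f : G → ℂ) (Φ : State m n G) : Prop :=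
  (∀ φ, Φ (gauge o φ 1) = f (φ v₀ * (φ v₁)⁻¹)) ∧ ∀ ω, Φ ω ≠ 0 → ∃ φ, ω = gauge o φ 1

variable {o : Orientation m n} {v₀ v₁ : Vertex m n} {f : G → ℂ} {Φ : State m n G}

theorem IsFlatState.gauge (h : IsFlatState o v₀ v₁ f Φ) {u : Vertex m n → G} (h₀ : u v₀ = 1)
    (h₁ : u v₁ = 1) (ω : Config m n G) : Φ (gauge o u ω) = Φ ω := by
  by_cases hω : ∃ φ, ω = QuantumDouble.gauge o φ 1
  · obtain ⟨φ, rfl⟩ := hω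
    rw [← gauge_mul, h.1, h.1]
    simp [h₀, h₁]
  · rw [not_imp_comm.mp (h.2 ω) hω, not_imp_comm.mp (h.2 _)]
    rintro ⟨φ, hφ⟩
    refine hω ⟨u⁻¹ * φ, ?_⟩
    rw [gauge_mul, ← hφ, ← gauge_mul, inv_mul_cancel, gauge_one]

variable [Fintype G] [DecidableEq G]

/-- The number of flat configurations in which a holonomy from `v₀` to `v₁` has a given value does
not depend on this value. -/
theorem IsFlatState.sum_norm_eq (h : IsFlatState o v₀ v₁ f Φ) (hv : v₀ ≠ v₁)
    {W : Config m n G → G} (hW : ∀ u ω, W (QuantumDouble.gauge o u ω) = u v₀ * W ω * (u v₁)⁻¹)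
    (hW₁ : W 1 = 1) :
    ∃ c : ℝ, 0 < c ∧ ∀ g, ∑ ω, ‖if W ω = g then Φ ω else 0‖ ^ 2 = c * ‖f g‖ ^ 2 := by
  classical
  let flat : G → Finset (Config m n G) := fun g =>
    Finset.univ.filter fun ω => (∃ φ, ω = QuantumDouble.gauge o φ 1) ∧ W ω = g
  have hcard : ∀ g, (flat g).card = (flat 1).card := by
    intro g
    -- A gauge transformation at `v₀` alone shifts the holonomy from `g` to `1`.
    let u : Vertex m n → G := fun v => if v = v₀ then g⁻¹ else 1
    refine Finset.card_equiv (gaugeEquiv o u) fun ω => ?_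
    have hWu : W (QuantumDouble.gauge o u ω) = g⁻¹ * W ω := by
      rw [hW]
      simp [u, hv.symm]
    change ω ∈ flat g ↔ QuantumDouble.gauge o u ω ∈ flat 1
    simp only [flat, Finset.mem_filter, Finset.mem_univ, true_and, hWu, inv_mul_eq_one]
    refine and_congr ⟨?_, ?_⟩ eq_comm
    · rintro ⟨φ, rfl⟩
      exact ⟨u * φ, by rw [gauge_mul]⟩
    · rintro ⟨φ, hφ⟩
      refine ⟨u⁻¹ * φ, ?_⟩
      rw [gauge_mul, ← hφ, ← gauge_mul, inv_mul_cancel, gauge_one]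
  refine ⟨(flat 1).card, ?_, fun g => ?_⟩
  · rw [Nat.cast_pos, Finset.card_pos]
    exact ⟨1, by simpa [flat, hW₁] using ⟨1, (gauge_one o 1).symm⟩⟩
  · rw [← hcard g, ← nsmul_eq_mul, ← Finset.sum_const, Finset.sum_filter]
    refine Finset.sum_congr rfl fun ω _ => ?_
    by_cases hω : (∃ φ, ω = QuantumDouble.gauge o φ 1) ∧ W ω = g
    · obtain ⟨⟨φ, rfl⟩, hg⟩ := hω
      rw [if_pos hg, if_pos ⟨⟨φ, rfl⟩, hg⟩, h.1, ← hg, hW, hW₁, mul_one]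
    · rw [if_neg hω]
      by_cases hg : W ω = g
      · have : Φ ω = 0 := not_imp_comm.mp (h.2 ω) fun hex => hω ⟨hex, hg⟩
        simp [this]
      · simp [hg]

end FlatStates

/-! ### Holonomies along arches -/

namespace Frame

variable {m n : ℕ} {G : Type*} [Group G] (F : Frame m n) (o : Orientation m n)

/-- The product of the group elements along the path which goes from row `j` up to row `j + l` in
column `a`, then to column `b`, and down to row `j'`. -/
def archProd (a b j j' t : ℕ) (ω : Config m n G) : G :=
  F.colProd o a j (t - j) ω * F.rowProd o t a (b - a) ω * (F.colProd o b j' (t - j') ω)⁻¹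

variable {F o}

theorem archProd_gauge {a b j j' t : ℕ} (hab : a ≤ b) (hb : b ≤ F.M) (hj : j ≤ t) (hj' : j' ≤ t)
    (ht : t ≤ F.N) (u : Vertex m n → G) (ω : Config m n G) :
    F.archProd o a b j j' t (gauge o u ω) =
      u (F.pt a j) * F.archProd o a b j j' t ω * (u (F.pt b j'))⁻¹ := by
  rw [archProd, archProd, colProd_gauge F o (by omega) (by omega),
    colProd_gauge F o (by omega) hb, rowProd_gauge F o (by omega) ht, Nat.add_sub_cancel' hj,
    Nat.add_sub_cancel' hj', Nat.add_sub_cancel' hab]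
  group

theorem archProd_one (a b j j' t : ℕ) : F.archProd o a b j j' t (1 : Config m n G) = 1 := by
  simp [archProd, colProd_one, rowProd_one]

theorem archProd_congr {a b j j' t : ℕ} (hab : a ≤ b) (hb : b ≤ F.M) (ht : t ≤ F.N)
    {ω ω' : Config m n G}
    (h : ∀ e, (F.x (Edge.low e) = a ∨ F.x (Edge.low e) = b ∨ F.y (Edge.low e) = t) →
      a ≤ F.x (Edge.low e) → F.x (Edge.low e) ≤ b → F.y (Edge.low e) ≤ t → ω e = ω' e) :
    F.archProd o a b j j' t ω = F.archProd o a b j j' t ω' := by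
  rw [archProd, archProd, F.colProd_congr o (i := a) (ω' := ω'), F.rowProd_congr o (ω' := ω'),
    F.colProd_congr o (i := b) (ω' := ω')]
  · intro k hk
    apply h
    all_goals try rw [F.x_low_ve (by omega) (by omega)]
    all_goals try rw [F.y_low_ve (by omega) (by omega)]
    all_goals omega
  · intro k hk
    apply h
    all_goals try rw [F.x_low_he (by omega) (by omega)]
    all_goals try rw [F.y_low_he (by omega) (by omega)]
    all_goals omega
  · intro k hk
    apply h
    all_goals try rw [F.x_low_ve (by omega) (by omega)]
    all_goals try rw [F.y_low_ve (by omega) (by omega)]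
    all_goals omega

/-- If a state is invariant under the operators which are diagonal in the holonomy along an arch,
then its values determine the part of the holonomy inside a strip under the arch. -/
theorem rowProd_eq_of_archProd_eq {a b j j' k₀ k₁ : ℕ} (ha : a < k₀) (hk : k₀ ≤ k₁) (hb : k₁ < b)
    (hbM : b ≤ F.M) {ω ω' : Config m n G} (hoff : ∀ e ∉ F.strip k₀ k₁, ω' e = ω e)
    (h : F.archProd o a b j j' F.N ω = F.archProd o a b j j' F.N ω') :
    F.rowProd o F.N k₀ (k₁ - k₀) ω = F.rowProd o F.N k₀ (k₁ - k₀) ω' := by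
  have hsplit : b - a = (k₀ - a) + ((k₁ - k₀) + (b - k₁)) := by omega
  have h1 : a + (k₀ - a) = k₀ := by omega
  have h2 : k₀ + (k₁ - k₀) = k₁ := by omega
  rw [archProd, archProd, hsplit, rowProd_add, rowProd_add, rowProd_add, rowProd_add, h1, h2,
    F.colProd_congr o (i := a) (ω := ω) (ω' := ω'),
    F.colProd_congr o (i := b) (ω := ω) (ω' := ω'),
    F.rowProd_congr o (a := a) (ω := ω) (ω' := ω'),
    F.rowProd_congr o (a := k₁) (ω := ω) (ω' := ω')] at h
  · simpa using h
  · intro k hk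
    refine (hoff _ fun he => ?_).symm
    have := he.2
    rw [F.x_high_he (by omega) le_rfl] at this
    omega
  · intro k hk
    refine (hoff _ fun he => ?_).symm
    have := he.1
    rw [F.x_low_he (by omega) le_rfl] at this
    omega
  · intro k hk
    refine (hoff _ fun he => ?_).symm
    have := he.2
    rw [F.x_high_ve (by omega) (by omega)] at this
    omega
  · intro k hk
    refine (hoff _ fun he => ?_).symm
    have := he.1
    rw [F.x_low_ve (by omega) (by omega)] at this
    omega

theorem mem_nbhd {r : ℕ} {A : Set (Edge m n)} {e : Edge m n} (h : e ∈ nbhd r A) :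
    ∃ f ∈ A, F.x (Edge.low e) ≤ F.x (Edge.low f) + r ∧ F.x (Edge.low f) ≤ F.x (Edge.low e) + r ∧
      F.y (Edge.low e) ≤ F.y (Edge.low f) + r ∧ F.y (Edge.low f) ≤ F.y (Edge.low e) + r := by
  obtain ⟨f, hf, hd⟩ := h
  have hd' : vertexDist (Edge.low f) (Edge.low e) ≤ r := by
    simpa only [vertexDist, Nat.dist_comm] using hd
  have h1 := F.x_le_add (Edge.low e) (Edge.low f)
  have h2 := F.x_le_add (Edge.low f) (Edge.low e)
  have h3 := F.y_le_add (Edge.low e) (Edge.low f)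
  have h4 := F.y_le_add (Edge.low f) (Edge.low e)
  exact ⟨f, hf, by omega, by omega, by omega, by omega⟩

/-! ### The main estimate -/

variable [Fintype G] [DecidableEq G]

/-- If a unitary operator of small range transforms the flat state with constant amplitudes into
the flat state with amplitudes `f`, then the values of `f` are not larger than their quadratic
mean. -/
theorem card_mul_norm_le (F : Frame m n) {v₀ v₁ : Vertex m n} {r : ℕ}
    (hx : F.x v₀ + 6 * r + 6 ≤ F.x v₁) (hy : 3 * r + 2 < F.N) {U : Op m n G}
    (hU : U ∈ Matrix.unitaryGroup (Config m n G) ℂ)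
    (hloc : ∀ (O : Op m n G) (A : Set (Edge m n)), SuppOn O A → SuppOn (U * O * Uᴴ) (nbhd r A))
    {f : G → ℂ} {Φ Ψ : State m n G} (hΦ : IsFlatState o v₀ v₁ f Φ)
    (hΨ : IsFlatState o v₀ v₁ (fun _ => (1 : ℂ)) Ψ) {z : ℂ} (hz : Φ = z • U *ᵥ Ψ) (g : G) :
    (Fintype.card G : ℝ) * ‖f g‖ ^ 2 ≤ ∑ h, ‖f h‖ ^ 2 := by
  classical
  have hx₁ := F.x_le v₁
  have hUU : Uᴴ * U = 1 := Matrix.mem_unitaryGroup_iff'.mp hU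
  have hUU' : U * Uᴴ = 1 := Matrix.mem_unitaryGroup_iff.mp hU
  have conj_mul : ∀ A B : Op m n G, U * A * Uᴴ * (U * B * Uᴴ) = U * (A * B) * Uᴴ := by
    intro A B
    calc U * A * Uᴴ * (U * B * Uᴴ) = U * A * (Uᴴ * U) * B * Uᴴ := by simp only [mul_assoc]
      _ = _ := by rw [hUU, mul_one]; simp only [mul_assoc]
  have conj_vec : ∀ A : Op m n G, (U * A * Uᴴ) *ᵥ Φ = z • U *ᵥ (A *ᵥ Ψ) := by
    intro A
    rw [hz, Matrix.mulVec_smul, Matrix.mulVec_mulVec, Matrix.mulVec_mulVec, mul_assoc, hUU,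
      mul_one]
  obtain ⟨x₀, hx₀⟩ : ∃ x₀, x₀ = F.x v₀ := ⟨_, rfl⟩
  obtain ⟨x₁, hx₁'⟩ : ∃ x₁, x₁ = F.x v₁ := ⟨_, rfl⟩
  -- From left to right stand the outer leg `x₀`, the inner leg `a`, the strip from `k₀` to `k₁`
  -- filled by the spread of column `c`, the inner leg `b` and the outer leg `x₁`; consecutive gaps
  -- exceed `r`. The choice of `ys` keeps even the row `ys - 1` above the spread of row `0`, and `y₀
  -- = ys + r` keeps the spread of the detour out of the lower strip; it stays below the top row
  -- because `y₀ + r < N`.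
  obtain ⟨a, ha⟩ : ∃ a, a = x₀ + r + 1 := ⟨_, rfl⟩
  obtain ⟨k₀, hk₀⟩ : ∃ k₀, k₀ = x₀ + 2 * r + 2 := ⟨_, rfl⟩
  obtain ⟨c, hc⟩ : ∃ c, c = k₀ + r := ⟨_, rfl⟩
  obtain ⟨k₁, hk₁⟩ : ∃ k₁, k₁ = c + r + 1 := ⟨_, rfl⟩
  obtain ⟨b, hb⟩ : ∃ b, b = x₀ + 5 * r + 5 := ⟨_, rfl⟩
  obtain ⟨ys, hys⟩ : ∃ ys, ys = r + 2 := ⟨_, rfl⟩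
  obtain ⟨y₀, hy₀⟩ : ∃ y₀, y₀ = 2 * r + 2 := ⟨_, rfl⟩
  rw [← hx₀, ← hx₁'] at hx
  rw [← hx₁'] at hx₁
  have hcM : c < F.M := by omega
  -- the three families of projections
  let W₁ : Config m n G → G := F.archProd o x₀ x₁ (F.y v₀) (F.y v₁) F.N
  let W₂ : Config m n G → G := F.rowProd o 0 a (b - a)
  let W₀ : Config m n G → G := F.archProd o a b 0 0 y₀
  let P : Op m n G := basisProj fun ω => W₁ ω = g
  let Q : G → Op m n G := fun k => U * basisProj (fun ω => W₂ ω = k) * Uᴴ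
  let Q₀ : G → Op m n G := fun k => U * basisProj (fun ω => W₀ ω = k) * Uᴴ
  let X : G → Op m n G := fun h => U * basisMap (F.dualString o c h) * Uᴴ
  have hW₁ : ∀ u ω, W₁ (gauge o u ω) = u v₀ * W₁ ω * (u v₁)⁻¹ := by
    intro u ω
    have := archProd_gauge (F := F) (o := o) (a := x₀) (b := x₁) (by omega) hx₁ (F.y_le v₀)
      (F.y_le v₁) le_rfl u ω
    rwa [hx₀, hx₁', F.pt_xy, F.pt_xy, ← hx₀, ← hx₁'] at this
  -- supports
  let S₁ : Set (Edge m n) :=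
    {e | F.x (Edge.low e) ≤ x₀ ∨ x₁ ≤ F.x (Edge.low e) ∨ F.y (Edge.low e) = F.N}
  let S₂ : Set (Edge m n) := {e | a ≤ F.x (Edge.low e) ∧ F.x (Edge.low e) ≤ b ∧
    F.y (Edge.low e) = 0}
  let S₀ : Set (Edge m n) := {e | (F.x (Edge.low e) = a ∨ F.x (Edge.low e) = b ∨
    F.y (Edge.low e) = y₀) ∧ a ≤ F.x (Edge.low e) ∧ F.x (Edge.low e) ≤ b ∧
    F.y (Edge.low e) ≤ y₀}
  let Up : Set (Edge m n) := {e | ys ≤ F.y (Edge.low e) + 1}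
  have sP : SuppOn P S₁ := by
    refine suppOn_basisProj fun ω ω' h hω => ?_
    rw [← hω]
    refine archProd_congr (by omega) hx₁ le_rfl fun e he _ _ _ => (h e ?_).symm
    rcases he with he | he | he
    · exact Or.inl he.le
    · exact Or.inr (Or.inl he.ge)
    · exact Or.inr (Or.inr he)
  have sQ : ∀ k, SuppOn (Q k) (nbhd r S₂) := by
    refine fun k => hloc _ _ (suppOn_basisProj fun ω ω' h hω => ?_)
    rw [← hω]
    refine F.rowProd_congr o fun i hi => (h _ ⟨?_, ?_, ?_⟩).symm
    · rw [F.x_low_he (by omega) (by omega)]; omega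
    · rw [F.x_low_he (by omega) (by omega)]; omega
    · rw [F.y_low_he (by omega) (by omega)]
  have sQ₀ : ∀ k, SuppOn (Q₀ k) (nbhd r S₀) := by
    refine fun k => hloc _ _ (suppOn_basisProj fun ω ω' h hω => ?_)
    rw [← hω]
    exact archProd_congr (by omega) (by omega) (by omega) fun e h1 h2 h3 h4 =>
      (h e ⟨h1, h2, h3, h4⟩).symm
  have sX : ∀ h, SuppOn (X h) (F.strip k₀ k₁) := by
    intro h
    refine (hloc _ _ (suppOn_dualString hcM h)).mono fun e he => ?_
    obtain ⟨e', he', h1, h2, -, -⟩ := F.mem_nbhd he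
    have hb := F.edge_bounds e
    have he'' : F.x (Edge.low e') = c := he'
    exact ⟨by omega, by omega⟩
  have d₁₂ : Disjoint S₁ (nbhd r S₂) := by
    rw [Set.disjoint_left]
    intro e he he'
    obtain ⟨e', ⟨h1, h2, h3⟩, h4, h5, h6, h7⟩ := F.mem_nbhd he'
    rcases he with he | he | he <;> omega
  have d₁₀ : Disjoint S₁ (nbhd r S₀) := by
    rw [Set.disjoint_left]
    intro e he he'
    obtain ⟨e', ⟨-, h1, h2, h3⟩, h4, h5, h6, h7⟩ := F.mem_nbhd he'
    rcases he with he | he | he <;> omega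
  have dUp : Disjoint Up (nbhd r S₂) := by
    rw [Set.disjoint_left]
    intro e he he'
    obtain ⟨e', ⟨h1, h2, h3⟩, h4, h5, h6, h7⟩ := F.mem_nbhd he'
    have : ys ≤ F.y (Edge.low e) + 1 := he
    omega
  have dLow : Disjoint (F.lowStrip k₀ k₁ ys) (nbhd r S₀) := by
    rw [Set.disjoint_left]
    intro e he he'
    obtain ⟨e', ⟨h0, h1, h2, h3⟩, h4, h5, h6, h7⟩ := F.mem_nbhd he'
    obtain ⟨h8, h9, h10⟩ := he
    have hb := F.edge_bounds e
    omega
  -- the transported projections agree on `Φ`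
  have hQQ₀ : ∀ k, Q k *ᵥ Φ = Q₀ k *ᵥ Φ := by
    intro k
    simp only [Q, Q₀]
    rw [conj_vec, conj_vec, basisProj_mulVec, basisProj_mulVec]
    congr 2
    funext ω
    by_cases hω : Ψ ω = 0
    · simp [hω]
    · obtain ⟨φ, rfl⟩ := hΨ.2 ω hω
      -- Both paths join `(a, 0)` to `(b, 0)`, so their holonomies coincide on flat configurations.
      have h1 : W₂ (gauge o φ 1) = W₀ (gauge o φ 1) := by
        simp only [W₂, W₀]
        rw [F.rowProd_gauge o (by omega) (by omega), archProd_gauge (by omega) (by omega)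
          (by omega) (by omega) (by omega), archProd_one, rowProd_one, Nat.add_sub_cancel' (by omega)]
      rw [h1]
  have cPQ : ∀ k, P * Q k = Q k * P := fun k => (sP.commute (sQ k) d₁₂).eq
  have cPQ₀ : ∀ k, P * Q₀ k = Q₀ k * P := fun k => (sP.commute (sQ₀ k) d₁₀).eq
  set χ : State m n G := P *ᵥ Φ with hχ
  have hQχ : ∀ k, Q₀ k *ᵥ χ = Q k *ᵥ χ := by
    intro k
    calc Q₀ k *ᵥ χ = (P * Q₀ k) *ᵥ Φ := by rw [cPQ₀, hχ, Matrix.mulVec_mulVec]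
      _ = (P * Q k) *ᵥ Φ := by
        rw [← Matrix.mulVec_mulVec, ← hQQ₀, Matrix.mulVec_mulVec]
      _ = Q k *ᵥ χ := by rw [cPQ, hχ, Matrix.mulVec_mulVec]
  -- properties of `χ` which are stable under `Q k`
  have hPχ : P *ᵥ χ = χ := by
    rw [hχ, Matrix.mulVec_mulVec, basisProj_mul_self]
  let D : Op m n G := basisProj fun ω => FlatOn o (F.upRegion k₀ k₁ ys) ω
  have sD : SuppOn D Up := by
    refine (suppOn_basisProj (S := F.upRegion k₀ k₁ ys) ?_).mono fun e he => he.2.2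
    rintro ω ω' h ⟨φ, hφ⟩
    exact ⟨φ, fun e he => by rw [← h e he, hφ e he]⟩
  have hDχ : D *ᵥ χ = χ := by
    refine basisProj_mulVec_eq_self_iff.mpr fun ω hω => ?_
    rw [hχ, basisProj_mulVec] at hω
    obtain ⟨φ, rfl⟩ := hΦ.2 ω fun h => hω (by simp [h])
    exact ⟨φ, fun e _ => rfl⟩
  have sA : ∀ u ∈ gaugeOn G (F.upVertices k₀ k₁ ys), SuppOn (basisMap (gauge o u)) Up := by
    intro u hu
    refine suppOn_basisMap (fun ω e he => ?_) fun ω ω' h e he => ?_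
    · have hb := F.edge_bounds e
      have he' : ¬ys ≤ F.y (Edge.low e) + 1 := he
      exact gauge_apply_of_eq_one (hu _ fun h => by have := h.2.2; omega)
        (hu _ fun h => by have := h.2.2; omega) ω
    · rw [gauge_apply_congr, h e he]
  have hA : ∀ (χ' : State m n G) (u : Vertex m n → G),
      basisMap (gauge o u) *ᵥ χ' = fun ω => χ' (gauge o u⁻¹ ω) :=
    fun χ' u => basisMap_mulVec (gaugeEquiv o u) χ'
  have hAχ : ∀ u ∈ gaugeOn G (F.upVertices k₀ k₁ ys), basisMap (gauge o u) *ᵥ χ = χ := by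
    intro u hu
    -- Both endpoints lie outside the strip, so `u` changes neither the arch holonomy nor the
    -- amplitudes of `Φ`.
    have h0 : u⁻¹ v₀ = 1 := inv_mem hu v₀ fun h => by have := h.1; omega
    have h1 : u⁻¹ v₁ = 1 := inv_mem hu v₁ fun h => by have := h.2.1; omega
    rw [hA, hχ, basisProj_mulVec]
    funext ω
    simp only [hW₁, h0, h1, hΦ.gauge h0 h1, one_mul, inv_one, mul_one]
  have good : ∀ (h : G), ∃ Y : Op m n G, SuppOn Y (F.lowStrip k₀ k₁ ys) ∧ ∀ χ' : State m n G,
      P *ᵥ χ' = χ' → D *ᵥ χ' = χ' →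
      (∀ u ∈ gaugeOn G (F.upVertices k₀ k₁ ys), basisMap (gauge o u) *ᵥ χ' = χ') →
      star χ' ⬝ᵥ X h *ᵥ χ' = star χ' ⬝ᵥ Y *ᵥ χ' := by
    intro h
    obtain ⟨Y, hY, hYχ⟩ := exists_suppOn_lowStrip (ys := ys) o (by omega : 1 ≤ k₀)
      (by omega : k₀ < k₁) (by omega) (by omega) (by omega) (sX h)
    refine ⟨Y, hY, fun χ' h1 h2 h3 => hYχ χ' (basisProj_mulVec_eq_self_iff.mp h2) ?_ ?_⟩
    · intro ω ω' hω hω' hoff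
      have h4 := basisProj_mulVec_eq_self_iff.mp h1
      exact rowProd_eq_of_archProd_eq (by omega) (by omega) (by omega) hx₁ hoff
        ((h4 ω hω).trans (h4 ω' hω').symm)
    · intro u hu ω
      have h4 := congrFun (h3 u⁻¹ (inv_mem hu)) ω
      rw [hA, inv_inv] at h4
      exact h4
  have conj_proj : ∀ (W : Config m n G → G) k,
      (U * basisProj (fun ω => W ω = k) * Uᴴ)ᴴ = U * basisProj (fun ω => W ω = k) * Uᴴ := by
    intro W k
    rw [Matrix.conjTranspose_mul, Matrix.conjTranspose_mul, conjTranspose_basisProj,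
      Matrix.conjTranspose_conjTranspose, mul_assoc]
  have move : ∀ (W : Config m n G → G) (k : G) (A : Op m n G) (v : State m n G),
      star ((U * basisProj (fun ω => W ω = k) * Uᴴ) *ᵥ v) ⬝ᵥ
        A *ᵥ ((U * basisProj (fun ω => W ω = k) * Uᴴ) *ᵥ v) =
      star v ⬝ᵥ ((U * basisProj (fun ω => W ω = k) * Uᴴ) * A *
        (U * basisProj (fun ω => W ω = k) * Uᴴ)) *ᵥ v := by
    intro W k A v
    rw [Matrix.star_mulVec, ← Matrix.dotProduct_mulVec, conj_proj, Matrix.mulVec_mulVec,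
      Matrix.mulVec_mulVec, ← mul_assoc]
  have hsum : ∑ k, Q₀ k = 1 := by
    simp only [Q₀]
    rw [← Finset.sum_mul, ← Finset.mul_sum, sum_basisProj_eq, mul_one, hUU']
  -- The chain is `⟨χ, X h χ⟩ = ⟨χ, Y χ⟩ = ∑ ⟨Q₀ k χ, Y Q₀ k χ⟩ = ∑ ⟨Q k χ, X h Q k χ⟩`, where every
  -- term of the last sum vanishes.
  have horth : ∀ h, h ≠ 1 → star χ ⬝ᵥ X h *ᵥ χ = 0 := by
    intro h hh
    obtain ⟨Y, hY, hYχ⟩ := good h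
    rw [hYχ χ hPχ hDχ hAχ]
    have hYsum : Y = ∑ k, Q₀ k * Y * Q₀ k := by
      calc Y = (∑ k, Q₀ k) * Y := by rw [hsum, one_mul]
        _ = ∑ k, Q₀ k * Y * Q₀ k := by
          rw [Finset.sum_mul]
          refine Finset.sum_congr rfl fun k _ => ?_
          have hidem : Q₀ k * Q₀ k = Q₀ k := by
            simp only [Q₀]
            rw [conj_mul, basisProj_mul_self]
          calc Q₀ k * Y = Q₀ k * Q₀ k * Y := by rw [hidem]
            _ = Q₀ k * (Y * Q₀ k) := by rw [mul_assoc, (hY.commute (sQ₀ k) dLow).eq]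
            _ = Q₀ k * Y * Q₀ k := (mul_assoc _ _ _).symm
    rw [hYsum, Matrix.sum_mulVec, dotProduct_sum]
    refine Finset.sum_eq_zero fun k _ => ?_
    rw [← move W₀ k Y χ]
    change star (Q₀ k *ᵥ χ) ⬝ᵥ Y *ᵥ (Q₀ k *ᵥ χ) = 0
    rw [hQχ, ← hYχ (Q k *ᵥ χ), move W₂ k (X h) χ]
    · simp only [X]
      rw [conj_mul, conj_mul, basisProj_mul_basisMap_mul_basisProj]
      · simp
      · intro ω h1 h2
        exact rowProd_dualString_ne (by omega) (by omega) (by omega) hh ω (h2.trans h1.symm)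
    -- The last three goals say that `Q k χ` inherits the properties of `χ`: the operators
    -- expressing them commute with `Q k`.
    · rw [Matrix.mulVec_mulVec, cPQ, ← Matrix.mulVec_mulVec, hPχ]
    · rw [Matrix.mulVec_mulVec, (sD.commute (sQ k) dUp).eq, ← Matrix.mulVec_mulVec, hDχ]
    · intro u hu
      rw [Matrix.mulVec_mulVec, ((sA u hu).commute (sQ k) dUp).eq, ← Matrix.mulVec_mulVec,
        hAχ u hu]
  have hXΦ : ∀ h, X h *ᵥ Φ = Φ := by
    intro h
    simp only [X]
    have h1 : basisMap (F.dualString o c h) *ᵥ Ψ = Ψ := by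
      rw [show F.dualString o c h = dualStringEquiv hcM o h from rfl, basisMap_mulVec]
      funext ω
      have hinv : ∀ (l : G) (η : Config m n G), Ψ η ≠ 0 → Ψ (F.dualString o c l η) = Ψ η := by
        intro l η hη
        obtain ⟨φ, rfl⟩ := hΨ.2 η hη
        obtain ⟨φ', hφ'⟩ := dualString_gauge_one (o := o) hcM l φ
        rw [hφ', hΨ.1, hΨ.1]
      change Ψ (F.dualString o c h⁻¹ ω) = Ψ ω
      by_cases hω : Ψ ω = 0
      · by_contra hne
        have h2 := hinv h (F.dualString o c h⁻¹ ω) fun h' => hne (by rw [h', hω])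
        rw [← dualString_mul hcM, mul_inv_cancel, dualString_one] at h2
        exact hne h2.symm
      · exact hinv _ _ hω
    rw [conj_vec, h1, ← hz]
  have hX₁ : X 1 = 1 := by
    have : F.dualString o c (1 : G) = id := funext fun ω => dualString_one ω
    simp only [X]
    rw [this, basisMap_id, mul_one, hUU']
  have hXX : ∀ h k, (X h)ᴴ * X k = X (h⁻¹ * k) := by
    intro h k
    simp only [X]
    have h1 : (basisMap (F.dualString o c h))ᴴ = basisMap (F.dualString o c h⁻¹) :=
      conjTranspose_basisMap (dualStringEquiv hcM o h)
    have h2 : F.dualString o c h⁻¹ ∘ F.dualString o c k = F.dualString o c (h⁻¹ * k) :=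
      funext fun ω => (dualString_mul hcM _ _ ω).symm
    rw [Matrix.conjTranspose_mul, Matrix.conjTranspose_mul, h1, Matrix.conjTranspose_conjTranspose,
      ← mul_assoc U, conj_mul, basisMap_mul_basisMap, h2]
  have hΦχ : star Φ ⬝ᵥ χ = star χ ⬝ᵥ χ := by
    rw [hχ, basisProj_mulVec]
    refine Finset.sum_congr rfl fun ω _ => ?_
    by_cases h : W₁ ω = g <;> simp [h]
  have hfinal := card_mul_norm_le_of_orthogonal hX₁ hXX hXΦ horth hΦχ
  obtain ⟨C, hC, hCf⟩ := hΦ.sum_norm_eq (W := W₁) (by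
    rintro rfl
    omega) hW₁ (archProd_one _ _ _ _ _)
  have h1 : (star χ ⬝ᵥ χ).re = C * ‖f g‖ ^ 2 := by
    rw [star_dotProduct_self, Complex.ofReal_re, hχ, basisProj_mulVec, hCf g]
  have h2 : (star Φ ⬝ᵥ Φ).re = C * ∑ h, ‖f h‖ ^ 2 := by
    rw [star_dotProduct_self, Complex.ofReal_re, Finset.mul_sum, Finset.sum_congr rfl fun h _ =>
      (hCf h).symm, Finset.sum_comm]
    refine Finset.sum_congr rfl fun ω _ => ?_
    rw [Finset.sum_eq_single (W₁ ω)]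
    · simp
    · intro h _ hh
      simp [hh.symm]
    · simp
  rw [h1, h2] at hfinal
  exact le_of_mul_le_mul_left (by linarith) hC

end Frame

/-! ### Irreducible unitary representations of finite groups -/

section Irreducible

variable {G : Type*} [Group G]

theorem matrixRep_apply {d : ℕ} (Γ : G →* Matrix.unitaryGroup (Fin d) ℂ) (g : G)
    (v : Fin d → ℂ) : matrixRep Γ g v = (Γ g : Matrix (Fin d) (Fin d) ℂ) *ᵥ v := rfl

open scoped InnerProductSpace in
/-- Restriction of a unitary representation to an invariant subspace, as a matrix representation. -/
theorem exists_unitary_matrixRep {E : Type*} [NormedAddCommGroup E] [InnerProductSpace ℂ E]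
    [FiniteDimensional ℂ E] (ρ : Representation ℂ G E) (hρ : ∀ g v w, ⟪ρ g v, ρ g w⟫_ℂ = ⟪v, w⟫_ℂ) :
    ∃ (Γ : G →* Matrix.unitaryGroup (Fin (Module.finrank ℂ E)) ℂ)
      (T : E ≃ₗ[ℂ] (Fin (Module.finrank ℂ E) → ℂ)), ∀ g v, T (ρ g v) = matrixRep Γ g (T v) := by
  let b := stdOrthonormalBasis ℂ E
  have hunit : ∀ g, star (ρ g) * ρ g = 1 := by
    intro g
    refine LinearMap.ext fun v => ext_inner_left ℂ fun w => ?_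
    rw [Module.End.mul_apply, LinearMap.star_eq_adjoint, LinearMap.adjoint_inner_right, hρ]
    rfl
  let Γ : G →* Matrix.unitaryGroup (Fin (Module.finrank ℂ E)) ℂ :=
    { toFun := fun g => ⟨LinearMap.toMatrixOrthonormal b (ρ g), by
        rw [Matrix.mem_unitaryGroup_iff', ← map_star, ← map_mul, hunit, map_one]⟩
      map_one' := by
        apply Subtype.ext
        simp
      map_mul' := fun g h => by
        apply Subtype.ext
        change LinearMap.toMatrixOrthonormal b (ρ (g * h)) =
          LinearMap.toMatrixOrthonormal b (ρ g) * LinearMap.toMatrixOrthonormal b (ρ h)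
        rw [map_mul, map_mul] }
  refine ⟨Γ, b.toBasis.equivFun, fun g v => ?_⟩
  rw [matrixRep_apply]
  funext i
  have := congrFun (LinearMap.toMatrix_mulVec_repr b.toBasis b.toBasis (ρ g) v) i
  exact this.symm

open scoped InnerProductSpace in
/-- If an element acts nontrivially in a unitary representation, then it acts nontrivially in an
irreducible one. -/
theorem exists_irreducible_of_apply_ne {E : Type*} [NormedAddCommGroup E] [InnerProductSpace ℂ E]
    [FiniteDimensional ℂ E] (ρ : Representation ℂ G E) (hρ : ∀ g v w, ⟪ρ g v, ρ g w⟫_ℂ = ⟪v, w⟫_ℂ)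
    {c : G} {w₀ : E} (hc : ρ c w₀ ≠ w₀) :
    ∃ (d : ℕ) (_ : NeZero d) (Γ : G →* Matrix.unitaryGroup (Fin d) ℂ),
      (matrixRep Γ).IsIrreducible ∧ Γ c ≠ 1 := by
  classical
  have hρinv : ∀ g v, ρ g (ρ g⁻¹ v) = v := fun g v => by
    rw [← Module.End.mul_apply, ← map_mul, mul_inv_cancel, map_one, Module.End.one_apply]
  -- A subrepresentation `S` of least dimension on which `c` acts nontrivially is irreducible: for
  -- an invariant `q` in `S`, `c` acts nontrivially on `q` or on its orthogonal complement in `S`,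
  -- and minimality makes that one all of `S`.
  let good : Subrepresentation ρ → Prop := fun S => ∃ w ∈ S.toSubmodule, ρ c w ≠ w
  have hex : ∃ k, ∃ S : Subrepresentation ρ, good S ∧ Module.finrank ℂ S.toSubmodule = k := by
    exact ⟨_, ⟨⊤, fun _ _ _ => Submodule.mem_top⟩, ⟨w₀, Submodule.mem_top, hc⟩, rfl⟩
  obtain ⟨S, ⟨w, hw, hcw⟩, hS⟩ := Nat.find_spec hex
  have hmin : ∀ S' : Subrepresentation ρ, S'.toSubmodule ≤ S.toSubmodule → good S' →
      S'.toSubmodule = S.toSubmodule := fun S' hle hg =>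
    Submodule.eq_of_le_of_finrank_le hle (hS ▸ Nat.find_min' hex ⟨S', hg, rfl⟩)
  obtain ⟨Γ, T, hT⟩ := exists_unitary_matrixRep S.toRepresentation fun g v w =>
    hρ g (v : E) w
  have hw0 : (⟨w, hw⟩ : S.toSubmodule) ≠ 0 := fun h => hcw (by
    rw [show w = 0 from congrArg Subtype.val h, map_zero])
  have hpos : 0 < Module.finrank ℂ S.toSubmodule :=
    Module.finrank_pos_iff_exists_ne_zero.mpr ⟨_, hw0⟩
  refine ⟨_, ⟨hpos.ne'⟩, Γ, ?_, fun h => ?_⟩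
  · have hnt : Nontrivial (Subrepresentation (matrixRep Γ)) := by
      refine ⟨⟨⊥, ⊤, fun h => hw0 ?_⟩⟩
      have h1 : T ⟨w, hw⟩ ∈ (⊥ : Subrepresentation (matrixRep Γ)) := h ▸ trivial
      exact (LinearEquiv.map_eq_zero_iff T).mp h1
    refine { hnt with eq_bot_or_eq_top := fun p => ?_ }
    let q : Subrepresentation ρ :=
      { toSubmodule := (p.toSubmodule.comap T.toLinearMap).map S.toSubmodule.subtype
        apply_mem_toSubmodule := by
          rintro g _ ⟨v, hv, rfl⟩
          refine ⟨S.toRepresentation g v, ?_, rfl⟩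
          change T (S.toRepresentation g v) ∈ p.toSubmodule
          rw [hT]
          exact p.apply_mem_toSubmodule g hv }
    let q' : Subrepresentation ρ :=
      { toSubmodule := S.toSubmodule ⊓ q.toSubmoduleᗮ
        apply_mem_toSubmodule := by
          rintro g v ⟨hv, hv'⟩
          refine ⟨S.apply_mem_toSubmodule g hv, fun u hu => ?_⟩
          rw [← hρinv g u, hρ]
          exact hv' _ (q.apply_mem_toSubmodule g⁻¹ hu) }
    have hqS : q.toSubmodule ≤ S.toSubmodule := Submodule.map_subtype_le _ _
    by_cases hq : good q
    · right
      have h1 := hmin q hqS hq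
      refine Subrepresentation.toSubmodule_injective (eq_top_iff.mpr fun x _ => ?_)
      obtain ⟨v, hv, hvx⟩ : (T.symm x : E) ∈ q.toSubmodule := by
        rw [h1]
        exact (T.symm x).2
      have h2 : v = T.symm x := Subtype.ext hvx
      have h3 : T v ∈ p.toSubmodule := hv
      rwa [h2, T.apply_symm_apply] at h3
    · left
      have hq' : good q' := by
        by_contra hcon
        refine hcw ?_
        have hsup := Submodule.sup_orthogonal_inf_of_hasOrthogonalProjection hqS
        rw [← hsup] at hw
        obtain ⟨y, hy, z, hz, rfl⟩ := Submodule.mem_sup.mp hw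
        have h1 : ρ c y = y := by
          by_contra hne
          exact hq ⟨y, hy, hne⟩
        have h2 : ρ c z = z := by
          by_contra hne
          exact hcon ⟨z, ⟨hz.2, hz.1⟩, hne⟩
        rw [map_add, h1, h2]
      have h1 := hmin q' inf_le_left hq'
      refine Subrepresentation.toSubmodule_injective (eq_bot_iff.mpr fun x hx => ?_)
      have h2 : (T.symm x : E) ∈ q.toSubmodule :=
        ⟨T.symm x, by simpa using hx, rfl⟩
      have h3 : (T.symm x : E) ∈ q'.toSubmodule := by
        rw [h1]
        exact (T.symm x).2
      have h4 : (T.symm x : E) = 0 := inner_self_eq_zero.mp (h3.2 _ h2)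
      have h5 : T.symm x = 0 := Subtype.ext h4
      exact (LinearEquiv.map_eq_zero_iff T.symm).mp h5
  · refine hcw ?_
    have h1 := hT c ⟨w, hw⟩
    rw [matrixRep_apply, h, OneMemClass.coe_one, Matrix.one_mulVec] at h1
    exact congrArg Subtype.val (T.injective h1)

/-- A unitary matrix whose diagonal entry at `i` has modulus one maps the `i`-th basis vector to a
multiple of itself. -/
theorem mulVec_single_of_norm_eq_one {d : ℕ} {M : Matrix (Fin d) (Fin d) ℂ}
    (hM : M ∈ Matrix.unitaryGroup (Fin d) ℂ) {i : Fin d} (h : ‖M i i‖ = 1) :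
    M *ᵥ Pi.single i 1 = M i i • Pi.single i 1 := by
  have h1 := congrFun (congrFun (Matrix.mem_unitaryGroup_iff'.mp hM) i) i
  rw [Matrix.mul_apply, Matrix.one_apply_eq] at h1
  -- Column `i` is a unit vector, so an entry of modulus one forces its other entries to vanish.
  have h2 : ∑ j, ‖M j i‖ ^ 2 = 1 := by
    have h3 : ((∑ j, ‖M j i‖ ^ 2 : ℝ) : ℂ) = 1 := by
      rw [← h1]
      push_cast
      exact Finset.sum_congr rfl fun j _ => by
        rw [Matrix.star_apply, ← Complex.conj_mul', starRingEnd_apply]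
    exact_mod_cast h3
  rw [← Finset.add_sum_erase _ _ (Finset.mem_univ i), h] at h2
  have h4 : ∑ j ∈ Finset.univ.erase i, ‖M j i‖ ^ 2 = 0 := by linarith
  rw [Finset.sum_eq_zero_iff_of_nonneg fun j _ => by positivity] at h4
  funext j
  by_cases hj : j = i
  · subst hj
    simp
  · have h5 := h4 j (by simp [hj])
    simpa [hj] using h5

/-- In an irreducible non-abelian unitary representation, no vector of an orthonormal basis is a
common eigenvector. -/
theorem exists_norm_apply_zero_lt_one {d : ℕ} [NeZero d] {Γ : G →* Matrix.unitaryGroup (Fin d) ℂ}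
    (hΓ : (matrixRep Γ).IsIrreducible) {a b : G} (hab : Γ (a * b) ≠ Γ (b * a))
    (W : Matrix.unitaryGroup (Fin d) ℂ) :
    ∃ g, ‖((W * Γ g * W⁻¹ : Matrix.unitaryGroup (Fin d) ℂ) : Matrix (Fin d) (Fin d) ℂ) 0 0‖ < 1 := by
  by_contra! hcon
  let e : Fin d → ℂ := Pi.single 0 1
  -- If all these entries had modulus one, `v` would be a common eigenvector of the `Γ g`. Its span
  -- would be invariant, hence the whole space, and `Γ a`, `Γ b` would commute.
  let v : Fin d → ℂ := ((W⁻¹ : Matrix.unitaryGroup (Fin d) ℂ) : Matrix (Fin d) (Fin d) ℂ) *ᵥ e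
  have hev : ∀ g, ∃ z : ℂ, matrixRep Γ g v = z • v := by
    intro g
    set M : Matrix.unitaryGroup (Fin d) ℂ := W * Γ g * W⁻¹ with hM
    have h1 : ‖(M : Matrix (Fin d) (Fin d) ℂ) 0 0‖ = 1 :=
      le_antisymm (entry_norm_bound_of_unitary M.2 0 0) (hcon g)
    have h2 := mulVec_single_of_norm_eq_one M.2 h1
    have h3 : Γ g * W⁻¹ = W⁻¹ * M := by rw [hM]; group
    refine ⟨(M : Matrix (Fin d) (Fin d) ℂ) 0 0, ?_⟩
    rw [matrixRep_apply, Matrix.mulVec_mulVec, ← Submonoid.coe_mul, h3, Submonoid.coe_mul,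
      ← Matrix.mulVec_mulVec, h2, Matrix.mulVec_smul]
  let p : Subrepresentation (matrixRep Γ) :=
    { toSubmodule := Submodule.span ℂ {v}
      apply_mem_toSubmodule := by
        intro g x hx
        obtain ⟨y, rfl⟩ := Submodule.mem_span_singleton.mp hx
        obtain ⟨z, hz⟩ := hev g
        rw [map_smul, hz]
        exact Submodule.smul_mem _ _ (Submodule.smul_mem _ _ (Submodule.mem_span_singleton_self v)) }
  have hv : v ≠ 0 := by
    intro h
    have h1 : (W : Matrix (Fin d) (Fin d) ℂ) *ᵥ v = e := by
      rw [Matrix.mulVec_mulVec, ← Submonoid.coe_mul, mul_inv_cancel, OneMemClass.coe_one,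
        Matrix.one_mulVec]
    rw [h, Matrix.mulVec_zero] at h1
    have := congrFun h1 0
    simp [e] at this
  rcases hΓ.eq_bot_or_eq_top p with h | h
  · refine hv ?_
    have h1 : v ∈ p := Submodule.mem_span_singleton_self v
    rw [h] at h1
    exact h1
  · refine hab (Subtype.ext (Matrix.toLinAlgEquiv'.injective (LinearMap.ext fun x => ?_)))
    change matrixRep Γ (a * b) x = matrixRep Γ (b * a) x
    have hx : x ∈ p := h ▸ trivial
    obtain ⟨y, rfl⟩ := Submodule.mem_span_singleton.mp hx
    obtain ⟨z, hz⟩ := hev a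
    obtain ⟨z', hz'⟩ := hev b
    simp only [map_mul, Module.End.mul_apply, map_smul, hz, hz', smul_smul]
    congr 1
    ring

variable [Fintype G]

/-- The left regular representation on the Hilbert space with orthonormal basis `G`. -/
def regularRep (G : Type*) [Group G] [Fintype G] :
    Representation ℂ G (EuclideanSpace ℂ G) where
  toFun g := (LinearIsometryEquiv.piLpCongrLeft 2 ℂ ℂ (Equiv.mulLeft g)).toLinearEquiv.toLinearMap
  map_one' := by
    ext v i
    simp [LinearIsometryEquiv.piLpCongrLeft_apply, Equiv.piCongrLeft', Equiv.mulLeft]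
  map_mul' g h := by
    ext v i
    simp [LinearIsometryEquiv.piLpCongrLeft_apply, Equiv.piCongrLeft', Equiv.mulLeft, mul_assoc]

theorem regularRep_apply (g : G) (v : EuclideanSpace ℂ G) (x : G) :
    regularRep G g v x = v (g⁻¹ * x) := rfl

/-- A finite group has an irreducible unitary representation in which a given nontrivial element
acts nontrivially. -/
theorem exists_irreducible_of_ne_one {c : G} (hc : c ≠ 1) :
    ∃ (d : ℕ) (_ : NeZero d) (Γ : G →* Matrix.unitaryGroup (Fin d) ℂ),
      (matrixRep Γ).IsIrreducible ∧ Γ c ≠ 1 := by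
  classical
  refine exists_irreducible_of_apply_ne (regularRep G) (fun g v w =>
    (LinearIsometryEquiv.piLpCongrLeft 2 ℂ ℂ (Equiv.mulLeft g)).inner_map_map v w)
    (w₀ := EuclideanSpace.single 1 1) fun h => ?_
  have h1 : regularRep G c (EuclideanSpace.single 1 1) c = EuclideanSpace.single 1 (1 : ℂ) c :=
    congrArg (fun v : EuclideanSpace ℂ G => v c) h
  rw [regularRep_apply] at h1
  simp [hc] at h1

end Irreducible

/-! ### The two coordinate systems of the lattice -/

namespace Frame

variable {m n : ℕ}

/-- The standard coordinates. The edge `e₀` is a junk value for edges outside the lattice. -/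
def std (e₀ : Edge m n) : Frame m n where
  M := m
  N := n
  pt i j := (Fin.ofNat (m + 1) i, Fin.ofNat (n + 1) j)
  x v := v.1
  y v := v.2
  he i j := if h : i < m ∧ j < n + 1 then Sum.inl (⟨i, h.1⟩, ⟨j, h.2⟩) else e₀
  ve i j := if h : i < m + 1 ∧ j < n then Sum.inr (⟨i, h.1⟩, ⟨j, h.2⟩) else e₀
  x_pt i j hi _ := Nat.mod_eq_of_lt (by omega)
  y_pt i j _ hj := Nat.mod_eq_of_lt (by omega)
  x_le v := by omega
  y_le v := by omega
  pt_xy v := by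
    ext
    · exact Nat.mod_eq_of_lt v.1.2
    · exact Nat.mod_eq_of_lt v.2.2
  low_he i j hi hj := by
    rw [dif_pos ⟨hi, by omega⟩]
    ext
    · exact (Nat.mod_eq_of_lt (by omega)).symm
    · exact (Nat.mod_eq_of_lt (by omega)).symm
  high_he i j hi hj := by
    rw [dif_pos ⟨hi, by omega⟩]
    ext
    · exact (Nat.mod_eq_of_lt (by omega)).symm
    · exact (Nat.mod_eq_of_lt (by omega)).symm
  low_ve i j hi hj := by
    rw [dif_pos ⟨by omega, hj⟩]
    ext
    · exact (Nat.mod_eq_of_lt (by omega)).symm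
    · exact (Nat.mod_eq_of_lt (by omega)).symm
  high_ve i j hi hj := by
    rw [dif_pos ⟨by omega, hj⟩]
    ext
    · exact (Nat.mod_eq_of_lt (by omega)).symm
    · exact (Nat.mod_eq_of_lt (by omega)).symm
  exists_edge e := by
    obtain ⟨i, j⟩ | ⟨i, j⟩ := e
    · exact Or.inl ⟨i, j, i.2, by omega, by rw [dif_pos ⟨i.2, j.2⟩]⟩
    · exact Or.inr ⟨i, j, by omega, j.2, by rw [dif_pos ⟨i.2, j.2⟩]⟩
  x_le_add v w := by
    simp only [vertexDist, Nat.dist]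
    omega
  y_le_add v w := by
    simp only [vertexDist, Nat.dist]
    omega

/-- The coordinate system with exchanged coordinates. -/
def swap (F : Frame m n) : Frame m n where
  M := F.N
  N := F.M
  pt i j := F.pt j i
  x := F.y
  y := F.x
  he i j := F.ve j i
  ve i j := F.he j i
  x_pt i j hi hj := F.y_pt j i hj hi
  y_pt i j hi hj := F.x_pt j i hj hi
  x_le := F.y_le
  y_le := F.x_le
  pt_xy := F.pt_xy
  low_he i j hi hj := F.low_ve j i hj hi
  high_he i j hi hj := F.high_ve j i hj hi
  low_ve i j hi hj := F.low_he j i hj hi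
  high_ve i j hi hj := F.high_he j i hj hi
  exists_edge e := (F.exists_edge e).symm.imp
    (fun ⟨i, j, hi, hj, h⟩ => ⟨j, i, hj, hi, h⟩) fun ⟨i, j, hi, hj, h⟩ => ⟨j, i, hj, hi, h⟩
  x_le_add := F.y_le_add
  y_le_add := F.x_le_add

variable {G : Type*} [Group G] {F : Frame m n} {o : Orientation m n}

/-- The potential at a vertex is the inverse of the transport from the origin along row `0` and then
up its column. Vertical edges are then right by construction; for horizontal ones the plaquette
relations are propagated upwards from row `0`. -/
theorem exists_eq_gauge_one {ω : Config m n G}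
    (h : ∀ i j, i < F.M → j < F.N → upRead o (F.he i j) ω * upRead o (F.ve (i + 1) j) ω =
      upRead o (F.ve i j) ω * upRead o (F.he i (j + 1)) ω) :
    ∃ φ, ω = gauge o φ 1 := by
  have key : ∀ i j, i < F.M → j ≤ F.N →
      F.rowProd o 0 0 i ω * F.colProd o i 0 j ω * upRead o (F.he i j) ω =
        F.rowProd o 0 0 (i + 1) ω * F.colProd o (i + 1) 0 j ω := by
    intro i j hi
    induction j with
    | zero => simp [colProd, rowProd]
    | succ j ih =>
      intro hj
      rw [colProd, colProd, ← mul_assoc, ← mul_assoc, ← ih (by omega), zero_add,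
        mul_assoc _ (upRead o (F.ve i j) ω), ← h i j hi (by omega), mul_assoc, mul_assoc, mul_assoc]
  refine ⟨fun v => (F.rowProd o 0 0 (F.x v) ω * F.colProd o (F.x v) 0 (F.y v) ω)⁻¹, ?_⟩
  funext e
  rw [← upRead_inj (o := o), upRead_gauge, upRead_one]
  obtain ⟨i, j, hi, hj, rfl⟩ | ⟨i, j, hi, hj, rfl⟩ := F.exists_edge e
  · rw [F.low_he i j hi hj, F.high_he i j hi hj, F.x_pt i j hi.le hj, F.y_pt i j hi.le hj,
      F.x_pt _ j hi hj, F.y_pt _ j hi hj, ← key i j hi hj]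
    group
  · rw [F.low_ve i j hi hj, F.high_ve i j hi hj, F.x_pt i j hi hj.le, F.y_pt i j hi hj.le,
      F.x_pt i _ hi hj, F.y_pt i _ hi hj, colProd, zero_add]
    group

end Frame

/-! ### Ground states -/

section GroundState

variable {m n : ℕ} {G : Type*} [Group G]

theorem readEdge_eq (o : Orientation m n) (s : Site m n) (ω : Config m n G) :
    readEdge o s ω = if s.dir then upRead o s.edge ω else (upRead o s.edge ω)⁻¹ := by
  by_cases h : s.dir = true <;> by_cases h' : o s.edge = true <;> simp [readEdge, upRead, h, h']

theorem flux_eq (o : Orientation m n) (p : Plaquette m n) (ω : Config m n G) :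
    flux o ⟨p, 0⟩ ω = upRead o (Sum.inl (p.1, p.2.castSucc)) ω *
      upRead o (Sum.inr (p.1.succ, p.2)) ω * (upRead o (Sum.inl (p.1, p.2.succ)) ω)⁻¹ *
      (upRead o (Sum.inr (p.1.castSucc, p.2)) ω)⁻¹ := by
  simp only [flux, readEdge_eq]
  simp [Site.dir, Site.edge]

theorem flux_gauge_one (o : Orientation m n) (p : Plaquette m n) (φ : Vertex m n → G) :
    flux o ⟨p, 0⟩ (gauge o φ 1) = 1 := by
  simp only [flux_eq, upRead_gauge, upRead_one, Edge.low, Edge.high]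
  group

/-- A configuration without fluxes on a simply connected lattice is gauge equivalent to `1`. -/
theorem exists_eq_gauge_one_of_flux (e₀ : Edge m n) {o : Orientation m n} {ω : Config m n G}
    (h : ∀ p, flux o ⟨p, 0⟩ ω = 1) : ∃ φ, ω = gauge o φ 1 := by
  refine (Frame.std e₀).exists_eq_gauge_one fun i j hi hj => ?_
  have hi' : i < m := hi
  have hj' : j < n := hj
  have h1 := h (⟨i, hi⟩, ⟨j, hj⟩)
  rw [flux_eq, mul_inv_eq_one, mul_inv_eq_iff_eq_mul] at h1
  simp only [Frame.std]
  rw [dif_pos ⟨hi', by omega⟩, dif_pos ⟨by omega, hj'⟩, dif_pos ⟨by omega, hj'⟩,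
    dif_pos ⟨hi', by omega⟩]
  exact h1

/-- A vector on which a sum of `k` orthogonal projections takes at least the value `k` is invariant
under all of them. -/
theorem mulVec_eq_self_of_sum {ι κ : Type*} [Fintype ι] [Fintype κ] {A : κ → Matrix ι ι ℂ}
    (hA : ∀ k, (A k)ᴴ = A k) (hA' : ∀ k, A k * A k = A k) {Ψ : ι → ℂ} {E : ℝ}
    (hE : (Fintype.card κ : ℝ) ≤ E) (h : (∑ k, A k) *ᵥ Ψ = (E : ℂ) • Ψ) (k : κ) :
    A k *ᵥ Ψ = Ψ := by
  have h1 : ∀ k, star (Ψ - A k *ᵥ Ψ) ⬝ᵥ (Ψ - A k *ᵥ Ψ) = star Ψ ⬝ᵥ Ψ - star Ψ ⬝ᵥ A k *ᵥ Ψ := by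
    intro k
    have h2 : star (A k *ᵥ Ψ) ⬝ᵥ A k *ᵥ Ψ = star Ψ ⬝ᵥ A k *ᵥ Ψ := by
      rw [Matrix.star_mulVec, ← Matrix.dotProduct_mulVec, Matrix.mulVec_mulVec, hA, hA']
    have h3 : star (A k *ᵥ Ψ) ⬝ᵥ Ψ = star Ψ ⬝ᵥ A k *ᵥ Ψ := by
      rw [Matrix.star_mulVec, ← Matrix.dotProduct_mulVec, hA]
    rw [star_sub, sub_dotProduct, dotProduct_sub, dotProduct_sub, h2, h3]
    ring
  have h3 : ∑ k, star Ψ ⬝ᵥ A k *ᵥ Ψ = E * (star Ψ ⬝ᵥ Ψ) := by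
    rw [← dotProduct_sum, ← Matrix.sum_mulVec, h, dotProduct_smul, smul_eq_mul]
  -- The squared defects `‖Ψ - A k Ψ‖²` add up to `(card κ - E) ‖Ψ‖² ≤ 0`, so each of them vanishes.
  have h4 : ∑ k, star (Ψ - A k *ᵥ Ψ) ⬝ᵥ (Ψ - A k *ᵥ Ψ) =
      ((Fintype.card κ : ℂ) - E) * (star Ψ ⬝ᵥ Ψ) := by
    rw [Finset.sum_congr rfl fun k _ => h1 k, Finset.sum_sub_distrib, h3, Finset.sum_const,
      Finset.card_univ, nsmul_eq_mul]
    ring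
  simp only [star_dotProduct_self] at h4
  have h5 : ∑ k, ∑ i, ‖(Ψ - A k *ᵥ Ψ) i‖ ^ 2 = ((Fintype.card κ : ℝ) - E) * ∑ i, ‖Ψ i‖ ^ 2 := by
    exact_mod_cast h4
  have h6 : ∑ k, ∑ i, ‖(Ψ - A k *ᵥ Ψ) i‖ ^ 2 = 0 := by
    refine le_antisymm ?_ (Finset.sum_nonneg fun k _ => Finset.sum_nonneg fun i _ => by positivity)
    rw [h5]
    exact mul_nonpos_of_nonpos_of_nonneg (by linarith)
      (Finset.sum_nonneg fun i _ => by positivity)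
  rw [Finset.sum_eq_zero_iff_of_nonneg fun k _ => Finset.sum_nonneg fun i _ => by positivity] at h6
  have h7 := h6 k (Finset.mem_univ k)
  rw [Finset.sum_eq_zero_iff_of_nonneg fun i _ => by positivity] at h7
  funext i
  have h8 : (Ψ - A k *ᵥ Ψ) i = 0 := by simpa using h7 i (Finset.mem_univ i)
  exact (sub_eq_zero.mp h8).symm

/-- The gauge parameter which is `g` at `v` and trivial elsewhere. -/
def gaugeAt (v : Vertex m n) (g : G) : Vertex m n → G := fun w => if w = v then g else 1

theorem gaugeAt_mul (v : Vertex m n) (g h : G) : gaugeAt v (g * h) = gaugeAt v g * gaugeAt v h := by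
  funext w
  by_cases hw : w = v <;> simp [gaugeAt, hw]

theorem gaugeAt_inv (v : Vertex m n) (g : G) : (gaugeAt v g)⁻¹ = gaugeAt v g⁻¹ := by
  funext w
  by_cases hw : w = v <;> simp [gaugeAt, hw]

variable [Fintype G] [DecidableEq G]

omit [Fintype G] in
theorem vertexOpAt_eq (o : Orientation m n) (v : Vertex m n) (g : G) :
    vertexOpAt o v g = basisMap (gaugeEquiv o (gaugeAt v g)) := by
  rw [vertexOpAt]
  congr 1
  funext ω e
  change _ = gaugeAt v g (o.tail e) * ω e * (gaugeAt v g (o.head e))⁻¹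
  by_cases h : o.head e = v <;> simp [gaugeAt, h]

theorem vertexOpAt_mul (o : Orientation m n) (v : Vertex m n) (g h : G) :
    vertexOpAt o v g * vertexOpAt o v h = vertexOpAt o v (g * h) := by
  rw [vertexOpAt_eq, vertexOpAt_eq, vertexOpAt_eq, basisMap_mul_basisMap]
  congr 1
  funext ω
  change gauge o (gaugeAt v g) (gauge o (gaugeAt v h) ω) = gauge o (gaugeAt v (g * h)) ω
  rw [← gauge_mul, gaugeAt_mul]

omit [Fintype G] in
theorem conjTranspose_vertexOpAt (o : Orientation m n) (v : Vertex m n) (g : G) :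
    (vertexOpAt o v g)ᴴ = vertexOpAt o v g⁻¹ := by
  rw [vertexOpAt_eq, vertexOpAt_eq, conjTranspose_basisMap]
  congr 1
  funext ω
  change gauge o (gaugeAt v g)⁻¹ ω = gauge o (gaugeAt v g⁻¹) ω
  rw [gaugeAt_inv]

theorem vertexOpAt_mul_vertexOp (o : Orientation m n) (v : Vertex m n) (g : G) :
    vertexOpAt o v g * vertexOp o v = vertexOp o v := by
  rw [vertexOp, Matrix.mul_smul, Finset.mul_sum, Finset.sum_congr rfl fun h _ =>
    vertexOpAt_mul o v g h]
  congr 1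
  exact Equiv.sum_comp (Equiv.mulLeft g) fun h => vertexOpAt o v h

theorem vertexOp_mul_self (o : Orientation m n) (v : Vertex m n) :
    (vertexOp o v : Op m n G) * vertexOp o v = vertexOp o v := by
  nth_rw 1 [vertexOp]
  rw [Matrix.smul_mul, Finset.sum_mul, Finset.sum_congr rfl fun h _ =>
    vertexOpAt_mul_vertexOp o v h, Finset.sum_const, Finset.card_univ, ← Nat.cast_smul_eq_nsmul ℂ,
    smul_smul, inv_mul_cancel₀ (Nat.cast_ne_zero.mpr Fintype.card_ne_zero), one_smul]

theorem conjTranspose_vertexOp (o : Orientation m n) (v : Vertex m n) :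
    (vertexOp o v : Op m n G)ᴴ = vertexOp o v := by
  rw [vertexOp, Matrix.conjTranspose_smul, Matrix.conjTranspose_sum, Finset.sum_congr rfl fun h _ =>
    conjTranspose_vertexOpAt o v h, show ∑ h, vertexOpAt o v h⁻¹ = ∑ h, vertexOpAt o v h from
      Equiv.sum_comp (Equiv.inv G) fun h => vertexOpAt o v h]
  simp

theorem vertexOpAt_mulVec (o : Orientation m n) (v : Vertex m n) (g : G) (Ψ : State m n G) :
    vertexOpAt o v g *ᵥ Ψ = fun ω => Ψ (gauge o (gaugeAt v g⁻¹) ω) := by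
  rw [vertexOpAt_eq, basisMap_mulVec]
  funext ω
  change Ψ (gauge o (gaugeAt v g)⁻¹ ω) = _
  rw [gaugeAt_inv]

/-- States that are invariant under all vertex operators are gauge invariant. -/
theorem apply_gauge_of_vertexOp {o : Orientation m n} {Ψ : State m n G}
    (h : ∀ v, vertexOp o v *ᵥ Ψ = Ψ) (u : Vertex m n → G) (ω : Config m n G) :
    Ψ (gauge o u ω) = Ψ ω := by
  classical
  have h1 : ∀ v g ω, Ψ (gauge o (gaugeAt v g) ω) = Ψ ω := by
    intro v g ω
    have h2 : vertexOpAt o v g⁻¹ *ᵥ Ψ = Ψ := by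
      rw [← h v, Matrix.mulVec_mulVec, vertexOpAt_mul_vertexOp]
    rw [vertexOpAt_mulVec, inv_inv] at h2
    exact congrFun h2 ω
  have h3 : ∀ (s : Finset (Vertex m n)) ω,
      Ψ (gauge o (fun v => if v ∈ s then u v else 1) ω) = Ψ ω := by
    intro s
    induction s using Finset.induction_on with
    | empty =>
      intro ω
      exact congrArg Ψ (gauge_one o ω)
    | insert a s ha ih =>
      intro ω
      have h4 : (fun v => if v ∈ insert a s then u v else 1) =
          gaugeAt a (u a) * fun v => if v ∈ s then u v else 1 := by
        funext v
        by_cases hv : v = a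
        · subst hv
          simp [gaugeAt, ha]
        · simp [gaugeAt, hv]
      rw [h4, gauge_mul, h1, ih]
  simpa using h3 Finset.univ ω

/-- The ground states are the multiples of the uniform superposition of all configurations without
fluxes. -/
theorem IsGroundState.isFlatState (e₀ : Edge m n) {o : Orientation m n} {Ψ : State m n G}
    (h : IsGroundState o Ψ) : ∃ c : ℂ, c ≠ 0 ∧ ∀ v₀ v₁, IsFlatState o v₀ v₁ (fun _ => c) Ψ := by
  classical
  obtain ⟨hΨ, E, hE, hmin⟩ := h
  let A : Vertex m n ⊕ Plaquette m n → Op m n G := Sum.elim (vertexOp o) (plaquetteOp o)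
  have hH : hamiltonian G o = -∑ k, A k := by
    rw [hamiltonian, Fintype.sum_sum_type]
    simp only [A, Sum.elim_inl, Sum.elim_inr]
    abel
  let Φ : State m n G := fun ω => if ∃ φ, ω = gauge o φ 1 then 1 else 0
  have hΦgauge : ∀ u ω, Φ (gauge o u ω) = Φ ω := by
    intro u ω
    simp only [Φ]
    refine if_congr ⟨?_, ?_⟩ rfl rfl
    · rintro ⟨φ, hφ⟩
      refine ⟨u⁻¹ * φ, ?_⟩
      rw [gauge_mul, ← hφ, ← gauge_mul, inv_mul_cancel, gauge_one]
    · rintro ⟨φ, rfl⟩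
      exact ⟨u * φ, by rw [gauge_mul]⟩
  have hΦ : ∀ k, A k *ᵥ Φ = Φ := by
    rintro (v | p)
    · simp only [A, Sum.elim_inl]
      rw [vertexOp, Matrix.smul_mulVec, Matrix.sum_mulVec, Finset.sum_congr rfl fun g _ =>
        (?_ : _ = Φ), Finset.sum_const, Finset.card_univ, ← Nat.cast_smul_eq_nsmul ℂ, smul_smul,
        inv_mul_cancel₀ (Nat.cast_ne_zero.mpr Fintype.card_ne_zero), one_smul]
      rw [vertexOpAt_mulVec]
      funext ω
      exact hΦgauge _ ω
    · simp only [A, Sum.elim_inr]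
      refine basisProj_mulVec_eq_self_iff.mpr fun ω hω => ?_
      by_cases hex : ∃ φ, ω = gauge o φ 1
      · obtain ⟨φ, rfl⟩ := hex
        exact flux_gauge_one o p φ
      · exact absurd (if_neg hex) hω
  have hΦ0 : Φ ≠ 0 := by
    intro h
    have h1 := congrFun h (gauge o 1 1)
    simp only [Φ] at h1
    rw [if_pos ⟨1, rfl⟩] at h1
    exact one_ne_zero h1
  -- The uniform flat state `Φ` is fixed by every term, so the ground state energy is at most minus
  -- the number of terms; this forces every term to fix `Ψ`.
  have hEle : E ≤ -(Fintype.card (Vertex m n ⊕ Plaquette m n) : ℝ) := by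
    refine hmin _ Φ hΦ0 ?_
    rw [hH, Matrix.neg_mulVec, Matrix.sum_mulVec, Finset.sum_congr rfl fun k _ => hΦ k,
      Finset.sum_const, Finset.card_univ, ← Nat.cast_smul_eq_nsmul ℂ]
    push_cast
    rw [neg_smul]
  have hAΨ : ∀ k, A k *ᵥ Ψ = Ψ := by
    refine mulVec_eq_self_of_sum (E := -E) ?_ ?_ (by linarith) ?_
    · rintro (v | p)
      · exact conjTranspose_vertexOp o v
      · exact conjTranspose_basisProj _
    · rintro (v | p)
      · exact vertexOp_mul_self o v
      · exact basisProj_mul_self _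
    · rw [hH, Matrix.neg_mulVec] at hE
      rw [Complex.ofReal_neg, neg_smul, ← hE, neg_neg]
  have hinv := apply_gauge_of_vertexOp fun v => hAΨ (Sum.inl v)
  have hflat : ∀ ω, Ψ ω ≠ 0 → ∃ φ, ω = gauge o φ 1 := fun ω hω =>
    exists_eq_gauge_one_of_flux e₀ fun p =>
      basisProj_mulVec_eq_self_iff.mp (hAΨ (Sum.inr p)) ω hω
  refine ⟨Ψ 1, fun h0 => hΨ ?_, fun v₀ v₁ => ⟨fun φ => hinv φ 1, hflat⟩⟩
  funext ω
  by_contra hω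
  obtain ⟨φ, rfl⟩ := hflat ω hω
  rw [hinv, h0] at hω
  exact hω rfl

end GroundState

/-! ### Fluxless ribbon operators -/

section Ribbon

variable {m n : ℕ} {G : Type*} [Group G]

/-- The product of the group elements along the primary triangles of a ribbon. -/
def ribbonProd (o : Orientation m n) : List (Triangle m n) → Config m n G → G
  | [], _ => 1
  | τ :: ξ, ω => (match τ.kind with
      | TriangleKind.primary => readEdge o τ.source ω
      | TriangleKind.dual => 1) * ribbonProd o ξ ω

theorem readEdge_gauge (o : Orientation m n) {s t : Site m n} (hp : t.plaquette = s.plaquette)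
    (hc : t.corner = s.corner - 1) (u : Vertex m n → G) (ω : Config m n G) :
    readEdge o s (gauge o u ω) = u s.vertex * readEdge o s ω * (u t.vertex)⁻¹ := by
  obtain ⟨p, c⟩ := s
  obtain ⟨p', c'⟩ := t
  obtain rfl : p' = p := hp
  obtain rfl : c' = c - 1 := hc
  rw [readEdge_eq, readEdge_eq, upRead_gauge]
  match c with
  | 0 =>
    simp [Site.dir, Site.edge, Site.vertex, Edge.low, Edge.high]
    rfl
  | 1 => simp [Site.dir, Site.edge, Site.vertex, Edge.low, Edge.high, mul_assoc]
  | 2 => simp [Site.dir, Site.edge, Site.vertex, Edge.low, Edge.high, mul_assoc]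
  | 3 => simp [Site.dir, Site.edge, Site.vertex, Edge.low, Edge.high]

/-- Gauge factors cancel between consecutive triangles: a primary triangle ends at the vertex where
the next one starts, and a dual triangle does not move the vertex. -/
theorem ribbonProd_gauge (o : Orientation m n) {s t : Site m n} {ξ : List (Triangle m n)}
    (h : IsStrip s ξ t) (u : Vertex m n → G) (ω : Config m n G) :
    ribbonProd o ξ (gauge o u ω) = u s.vertex * ribbonProd o ξ ω * (u t.vertex)⁻¹ := by
  induction h with
  | nil s => simp [ribbonProd]
  | cons τ v t l hτ _ ih =>
    obtain ⟨k, s⟩ := τ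
    cases k with
    | primary =>
      obtain ⟨hp, hc⟩ : v.plaquette = s.plaquette ∧ v.corner = s.corner - 1 := hτ
      simp only [ribbonProd]
      rw [ih, readEdge_gauge o hp hc]
      group
    | dual =>
      obtain ⟨hv, -⟩ : v.vertex = s.vertex ∧ v.corner = s.corner + 1 := hτ
      simp only [ribbonProd]
      rw [ih, hv, one_mul, one_mul]

theorem ribbonProd_one (o : Orientation m n) (ξ : List (Triangle m n)) :
    ribbonProd o ξ (1 : Config m n G) = 1 := by
  induction ξ with
  | nil => rfl
  | cons τ ξ ih =>
    obtain ⟨k, s⟩ := τ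
    cases k <;> simp [ribbonProd, ih, readEdge]

variable [Fintype G] [DecidableEq G]

/-- For `h = 1` dual triangles act trivially and all conjugates of `h` remain `1`; the
co-multiplication rule just splits the product of the group elements read. -/
theorem ribbonOp_one (o : Orientation m n) (ξ : List (Triangle m n)) (g : G) :
    ribbonOp o ξ 1 g = basisProj fun ω => ribbonProd o ξ ω = g := by
  induction ξ generalizing g with
  | nil =>
    ext ω' ω
    by_cases h : g = 1
    · simp [ribbonOp, ribbonProd, basisProj, h]
    · simp [ribbonOp, ribbonProd, basisProj, h, Ne.symm h]
  | cons τ ξ ih =>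
    obtain ⟨k, s⟩ := τ
    simp only [ribbonOp, mul_one, inv_mul_cancel, ih]
    cases k with
    | primary =>
      simp only [triangleOp, ribbonProd, basisProj, Matrix.diagonal_mul_diagonal]
      ext ω' ω
      rw [Matrix.sum_apply]
      simp only [Matrix.diagonal_apply]
      split_ifs with hω hg
      · rw [Finset.sum_eq_single (readEdge o s ω')]
        · simp [← hg]
        · intro k _ hk
          rw [if_neg (Ne.symm hk), zero_mul]
        · simp
      · refine Eq.trans ?_ (if_neg hg).symm
        refine Finset.sum_eq_zero fun k _ => ?_
        by_cases hk : readEdge o s ω' = k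
        · have h1 : ribbonProd o ξ ω' ≠ k⁻¹ * g := fun h => hg (by rw [hk, h, mul_inv_cancel_left])
          rw [if_neg h1, mul_zero]
        · rw [if_neg hk, zero_mul]
      · exact Finset.sum_const_zero
    | dual =>
      have h1 : basisMap (mulEdge o s (1 : G)) = 1 := by
        rw [← basisMap_id]
        congr 1
        funext ω
        simp [mulEdge]
      have h2 : basisProj (fun ω => ribbonProd o (⟨TriangleKind.dual, s⟩ :: ξ) ω = g) =
          basisProj fun ω => ribbonProd o ξ ω = g := by
        ext ω' ω
        simp [basisProj, ribbonProd]
      rw [h2]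
      simp only [triangleOp]
      rw [Finset.sum_eq_single (1 : G)]
      · rw [if_pos rfl, h1, one_mul]
        congr 1
        simp
      · intro k _ hk
        rw [if_neg hk, zero_mul]
      · simp

theorem anyonicRibbonOp_one_mulVec (o : Orientation m n) (ξ : List (Triangle m n)) {d : ℕ}
    [NeZero d] (Γ : G →* Matrix.unitaryGroup (Fin d) ℂ) (Ψ : State m n G) :
    anyonicRibbonOp o ξ 1 (Γ.comp (Subgroup.centralizer ({1} : Set G)).subtype) *ᵥ Ψ =
      fun ω => ((d : ℂ) / Nat.card (Subgroup.centralizer ({1} : Set G)) *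
        (((Γ (ribbonProd o ξ ω))⁻¹ : Matrix.unitaryGroup (Fin d) ℂ) :
          Matrix (Fin d) (Fin d) ℂ) 0 0) * Ψ ω := by
  classical
  funext ω
  have hmem : ∀ x : G, x ∈ Subgroup.centralizer ({1} : Set G) := fun x => by
    simp [Subgroup.mem_centralizer_iff]
  simp only [anyonicRibbonOp, anyonicRibbonOpAt, mul_one, one_mul, inv_one, ribbonOp_one,
    Matrix.smul_mulVec, Matrix.sum_mulVec, Pi.smul_apply, Finset.sum_apply, smul_eq_mul,
    basisProj_mulVec, mul_assoc]
  congr 1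
  rw [Finset.sum_eq_single ⟨ribbonProd o ξ ω, hmem _⟩]
  · simp
  · intro k _ hk
    rw [if_neg, mul_zero]
    intro h
    exact hk (Subtype.ext h.symm)
  · simp

end Ribbon

/-! ### The lower bound on the depth -/

section Main

variable {m n : ℕ} {G : Type*} [Group G]

/-- Allows the endpoints to be ordered by their first coordinate. -/
theorem IsFlatState.symm {o : Orientation m n} {v₀ v₁ : Vertex m n} {f : G → ℂ} {Φ : State m n G}
    (h : IsFlatState o v₀ v₁ f Φ) : IsFlatState o v₁ v₀ (fun g => f g⁻¹) Φ :=
  ⟨fun φ => by rw [h.1]; simp, h.2⟩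

variable [Fintype G] [DecidableEq G]

/-- The distance is the sum of two coordinate differences, so one of them is at least `6 * r + 6`;
`Frame.swap` makes it the horizontal one if necessary. -/
theorem card_mul_norm_le_of_dist (e₀ : Edge m n) {o : Orientation m n} {v₀ v₁ : Vertex m n}
    {r : ℕ} (hd : 12 * r + 12 ≤ vertexDist v₀ v₁) (hm : 3 * r + 2 < m) (hn : 3 * r + 2 < n)
    {U : Op m n G} (hU : U ∈ Matrix.unitaryGroup (Config m n G) ℂ)
    (hloc : ∀ (O : Op m n G) (A : Set (Edge m n)), SuppOn O A → SuppOn (U * O * Uᴴ) (nbhd r A))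
    {f : G → ℂ} {Φ Ψ : State m n G} (hΦ : IsFlatState o v₀ v₁ f Φ)
    (hΨ : ∀ v₀ v₁, IsFlatState o v₀ v₁ (fun _ => (1 : ℂ)) Ψ) {z : ℂ} (hz : Φ = z • U *ᵥ Ψ) :
    (Fintype.card G : ℝ) * ‖f 1‖ ^ 2 ≤ ∑ h, ‖f h‖ ^ 2 := by
  have key : ∀ F : Frame m n, 3 * r + 2 < F.N →
      F.x v₀ + 6 * r + 6 ≤ F.x v₁ ∨ F.x v₁ + 6 * r + 6 ≤ F.x v₀ →
      (Fintype.card G : ℝ) * ‖f 1‖ ^ 2 ≤ ∑ h, ‖f h‖ ^ 2 := by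
    rintro F hN (hx | hx)
    · exact F.card_mul_norm_le hx hN hU hloc hΦ (hΨ _ _) hz 1
    · have := F.card_mul_norm_le hx hN hU hloc hΦ.symm (hΨ _ _) hz 1
      rwa [inv_one, show ∑ h : G, ‖f h⁻¹‖ ^ 2 = ∑ h, ‖f h‖ ^ 2 from
        Equiv.sum_comp (Equiv.inv G) fun h => ‖f h‖ ^ 2] at this
  simp only [vertexDist, Nat.dist] at hd
  by_cases hx : (v₀.1 : ℕ) + 6 * r + 6 ≤ v₁.1 ∨ (v₁.1 : ℕ) + 6 * r + 6 ≤ v₀.1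
  · exact key (Frame.std e₀) hn hx
  · refine key (Frame.std e₀).swap hm ?_
    change (v₀.2 : ℕ) + 6 * r + 6 ≤ v₁.2 ∨ (v₁.2 : ℕ) + 6 * r + 6 ≤ v₀.2
    omega

/-- For every noncommutative finite group there is an irreducible representation whose fluxless ribbon
operators cannot be implemented on a ground state by shallow local circuits. -/
theorem exists_irreducible_depth_lower_bound (hG : ∃ a b : G, a * b ≠ b * a) :
    ∃ (d : ℕ) (_ : NeZero d) (Γ : G →* Matrix.unitaryGroup (Fin d) ℂ),
      (matrixRep Γ).IsIrreducible ∧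
      ∀ R : ℕ, ∃ c : ℝ, 0 < c ∧
        ∀ (W : Matrix.unitaryGroup (Fin d) ℂ)
          (m n : ℕ) (o : Orientation m n)
          (s₀ s₁ : Site m n) (ξ : List (Triangle m n)),
          IsOpenRibbon s₀ ξ s₁ →
          ∀ Ψ : State m n G, IsGroundState o Ψ →
          ∀ (t : ℕ) (U : Op m n G), IsLocalCircuit R t U →
            (∃ z : ℂ, U *ᵥ Ψ =
              z • (anyonicRibbonOp o ξ 1
                (((MulAut.conj W).toMonoidHom.comp Γ).comp
                  (Subgroup.centralizer ({1} : Set G)).subtype) *ᵥ Ψ)) →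
            c * (min (vertexDist s₀.vertex s₁.vertex) (min m n) : ℕ) ≤ (t : ℝ) := by
  classical
  obtain ⟨a, b, hab⟩ := hG
  have hcomm : a * b * (b * a)⁻¹ ≠ 1 := fun h => hab (mul_inv_eq_one.mp h)
  obtain ⟨d, hd, Γ, hΓ, hΓc⟩ := exists_irreducible_of_ne_one hcomm
  have hΓab : Γ (a * b) ≠ Γ (b * a) := fun h => hΓc (by rw [map_mul, h, ← map_mul]; simp)
  -- Conjugation by a circuit of depth `t` spreads supports by `r = R * t`, and `12 * r + 12 ≤ 12 *
  -- (R + 1) * t` once `t ≥ 1`.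
  refine ⟨d, hd, Γ, hΓ, fun R => ⟨1 / (12 * (R + 1)), by positivity, ?_⟩⟩
  intro W m n o s₀ s₁ ξ hξ Ψ hΨ t U hU ⟨z, hz⟩
  have e₀ : Edge m n := s₀.edge
  obtain ⟨c, hc, hΨc⟩ := hΨ.isFlatState e₀
  set Γ' : G →* Matrix.unitaryGroup (Fin d) ℂ := (MulAut.conj W).toMonoidHom.comp Γ with hΓ'
  let f : G → ℂ := fun g => ((d : ℂ) / Nat.card (Subgroup.centralizer ({1} : Set G)) *
    (((Γ' g)⁻¹ : Matrix.unitaryGroup (Fin d) ℂ) : Matrix (Fin d) (Fin d) ℂ) 0 0) * c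
  set Φ := anyonicRibbonOp o ξ 1 (Γ'.comp (Subgroup.centralizer ({1} : Set G)).subtype) *ᵥ Ψ
    with hΦdef
  set C : ℂ := (d : ℂ) / Nat.card (Subgroup.centralizer ({1} : Set G)) * c with hC
  have hC0 : C ≠ 0 := mul_ne_zero (div_ne_zero (Nat.cast_ne_zero.mpr hd.out)
    (Nat.cast_ne_zero.mpr Nat.card_pos.ne')) hc
  have hf : ∀ g, ‖f g‖ =
      ‖C‖ * ‖(((Γ' g)⁻¹ : Matrix.unitaryGroup (Fin d) ℂ) : Matrix (Fin d) (Fin d) ℂ) 0 0‖ := by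
    intro g
    rw [hC, ← norm_mul]
    congr 1
    simp only [f]
    ring
  have hf1 : ‖f 1‖ = ‖C‖ := by simp [hf]
  have hfle : ∀ g, ‖f g‖ ≤ ‖f 1‖ := by
    intro g
    rw [hf1, hf]
    exact mul_le_of_le_one_right (norm_nonneg _) (entry_norm_bound_of_unitary (Γ' g)⁻¹.2 0 0)
  obtain ⟨g₀, hg₀⟩ : ∃ g, ‖f g‖ < ‖f 1‖ := by
    obtain ⟨g, hg⟩ := exists_norm_apply_zero_lt_one hΓ hΓab W
    refine ⟨g⁻¹, ?_⟩
    rw [hf1, hf]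
    refine mul_lt_of_lt_one_right (norm_pos_iff.mpr hC0) ?_
    rw [map_inv, inv_inv]
    exact hg
  have hΦ : IsFlatState o s₀.vertex s₁.vertex f Φ := by
    rw [hΦdef, anyonicRibbonOp_one_mulVec]
    refine ⟨fun φ => ?_, fun ω hω => (hΨc s₀.vertex s₁.vertex).2 ω (right_ne_zero_of_mul hω)⟩
    beta_reduce
    rw [ribbonProd_gauge o hξ.2.1, ribbonProd_one, mul_one, (hΨc s₀.vertex s₁.vertex).1]
  by_contra! hlt
  set D : ℕ := min (vertexDist s₀.vertex s₁.vertex) (min m n) with hD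
  have hDlt : 12 * (R + 1) * t < D := by
    have h1 : (0 : ℝ) < 12 * (R + 1) := by positivity
    rw [one_div, inv_mul_eq_div, lt_div_iff₀ h1] at hlt
    have h2 : ((12 * (R + 1) * t : ℕ) : ℝ) < D := by
      push_cast
      linarith
    exact_mod_cast h2
  have hz0 : z ≠ 0 := by
    rintro rfl
    rw [zero_smul] at hz
    refine hΨ.1 ?_
    rw [← Matrix.one_mulVec Ψ, ← Matrix.mem_unitaryGroup_iff'.mp hU.mem_unitaryGroup,
      ← Matrix.mulVec_mulVec, hz, Matrix.mulVec_zero]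
  -- Depth zero is separate, because the endpoints may then be too close for the main estimate. The
  -- circuit is the identity, so `f` would be constant.
  rcases Nat.eq_zero_or_pos t with rfl | ht
  · obtain ⟨l, hl, -, rfl⟩ := hU
    rw [List.length_eq_zero_iff] at hl
    subst hl
    rw [List.prod_nil, Matrix.one_mulVec] at hz
    have hne : s₁.vertex ≠ s₀.vertex := by
      intro h
      rw [h, vertexDist_self] at hD
      omega
    have h1 : ∀ g, c = z * f g := by
      intro g
      have h2 := congrFun hz (gauge o (gaugeAt s₀.vertex g) 1)
      rw [(hΨc s₀.vertex s₁.vertex).1, Pi.smul_apply, hΦ.1] at h2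
      simpa [gaugeAt, hne] using h2
    have h3 : f g₀ = f 1 := mul_left_cancel₀ hz0 ((h1 g₀).symm.trans (h1 1))
    rw [h3] at hg₀
    exact lt_irrefl _ hg₀
  · have hr : 12 * (R * t) + 12 ≤ 12 * (R + 1) * t := by nlinarith
    have hΨ1 : ∀ v₀ v₁, IsFlatState o v₀ v₁ (fun _ => (1 : ℂ)) (c⁻¹ • Ψ) := by
      intro v₀ v₁
      refine ⟨fun φ => ?_, fun ω hω => (hΨc v₀ v₁).2 ω (right_ne_zero_of_mul hω)⟩
      rw [Pi.smul_apply, (hΨc v₀ v₁).1, smul_eq_mul, inv_mul_cancel₀ hc]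
    have hbound := card_mul_norm_le_of_dist e₀ (r := R * t) (by omega) (by omega) (by omega)
      hU.mem_unitaryGroup (fun O A hO => hU.suppOn_conj hO) hΦ hΨ1 (z := z⁻¹ * c) (by
        rw [Matrix.mulVec_smul, smul_smul, mul_assoc, mul_inv_cancel₀ hc, mul_one, hz, smul_smul,
          inv_mul_cancel₀ hz0, one_smul])
    -- The main estimate bounds `‖f 1‖²` by the mean of the `‖f h‖²`, but `‖f 1‖` is their maximum
    -- and is not attained at `g₀`.
    have hstrict : ∑ h, ‖f h‖ ^ 2 < ∑ _h : G, ‖f 1‖ ^ 2 :=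
      Finset.sum_lt_sum (fun g _ => pow_le_pow_left₀ (norm_nonneg _) (hfle g) 2)
        ⟨g₀, Finset.mem_univ _, pow_lt_pow_left₀ hg₀ (norm_nonneg _) two_ne_zero⟩
    rw [Finset.sum_const, Finset.card_univ, nsmul_eq_mul] at hstrict
    exact absurd hbound (not_le.mpr hstrict)

end Main

end QuantumDouble

end

theorem mainTheorem2 {G : Type*} [Group G] [Fintype G] [DecidableEq G]
    (hG : ∃ a b : G, a * b ≠ b * a) :
    ∃ (d : ℕ) (_ : NeZero d) (Γ : G →* Matrix.unitaryGroup (Fin d) ℂ),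
      (QuantumDouble.matrixRep Γ).IsIrreducible ∧
      ∀ R : ℕ, ∃ c : ℝ, 0 < c ∧
        ∀ (W : Matrix.unitaryGroup (Fin d) ℂ)
          (m n : ℕ) (o : QuantumDouble.Orientation m n)
          (s₀ s₁ : QuantumDouble.Site m n) (ξ : List (QuantumDouble.Triangle m n)),
          QuantumDouble.IsOpenRibbon s₀ ξ s₁ →
          ∀ Ψ : QuantumDouble.State m n G, QuantumDouble.IsGroundState o Ψ →
          ∀ (t : ℕ) (U : QuantumDouble.Op m n G), QuantumDouble.IsLocalCircuit R t U →
            (∃ z : ℂ, U *ᵥ Ψ =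
              z • (QuantumDouble.anyonicRibbonOp o ξ 1
                (((MulAut.conj W).toMonoidHom.comp Γ).comp
                  (Subgroup.centralizer ({1} : Set G)).subtype) *ᵥ Ψ)) →
            c * (min (QuantumDouble.vertexDist s₀.vertex s₁.vertex) (min m n) : ℕ) ≤ (t : ℝ) :=
  QuantumDouble.exists_irreducible_depth_lower_bound hG
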